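/- Let $m\equiv 3\pmod 8$ be a positive integer, $n=2^m-1$, and let $\alpha$ be a generator of $\mathbb{F}_{2^m}^*$. For $j\ge 0$ let $w_2(j)$ be the number of ones in the binary expansion of $j$. For $S\subset\mathbb{Z}_8$ with $|S|=4$ put $S'=\mathbb{Z}_8\setminus S$ and $T_S=\{1\le j\le n-1: w_2(j)\bmod 8\in S\}$, and let $\mathcal{C}_S$ be the binary cyclic code of length $n$ with generator polynomial $\prod_{i\in T_S}(x-\alpha^i)$, which lies in $\mathbb{F}_2[x]$. The defining set of a binary cyclic code of length $n$ with generator polynomial $g$ is $\{i\in\mathbb{Z}_n: g(\alpha^i)=0\}$. Two binary cyclic codes of length $n$ form a pair of odd-like (respectively even-like) duadic codes if their defining sets are $S_1,S_2$ (respectively $\{0\}\cup S_1,\{0\}\cup S_2$), where $S_1,S_2$ are unions of $2$-cyclotomic cosets modulo $n$ which partition $\mathbb{Z}_n\setminus\{0\}$ and are interchanged by multiplication by some unit $\mu$ of $\mathbb{Z}_n$. For a binary code $\mathcal{C}$ of length $n$ its extended code is $\overline{\mathcal{C}}=\{(c_0,\dots,c_n): (c_0,\dots,c_{n-1})\in\mathcal{C},\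 \sum_{i=0}^n c_i=0\}$. A code has parameters $[N,k,d]$ if it has length $N$, dimension $k$ and minimum distance $d$. (1) Let $S$ be one of $\{0,1,4,6\}$, $\{0,1,6,7\}$, $\{0,2,4,5\}$, $\{0,2,5,7\}$. Then: (1.1) $\mathcal{C}_S$ and $\mathcal{C}_{S'}$ form a pair of odd-like duadic codes, both with parameters $[2^m-1,2^{m-1},d]$, where $d\ge 2^{(m-1)/2}+1$ if $m\equiv 3\pmod{16}$ and $d\ge 2^{(m-1)/2}+3$ if $m\equiv 11\pmod{16}$. (1.2) The dual codes $\mathcal{C}_S^\perp$ and $\mathcal{C}_{S'}^\perp$ form a pair of even-like duadic codes, both with parameters $[2^m-1,2^{m-1}-1,d^\perp]$, where $d^\perp\ge 2^{(m-1)/2}+2$ if $m\equiv 3\pmod{16}$ and $d^\perp\ge 2^{(m-1)/2}+4$ if $m\equiv 11\pmod{16}$. (1.3) The extended codes $\overline{\mathcal{C}_S}$ and $\overline{\mathcal{C}_{S'}}$ are self-dual and doubly-even (all weights are divisible by $4$), and both have parameters $[2^m,2^{m-1},\overline d]$, where $\overline d\ge 2^{(m-1)/2}+4$ if $m\ne 3$.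 (2) Let $S$ be $\{0,1,5,7\}$ or $\{0,2,6,7\}$. Then: (2.1) $\mathcal{C}_S$ and $\mathcal{C}_{S'}$ form a pair of odd-like duadic codes, both with parameters $[2^m-1,2^{m-1},d]$, where $d\ge 2^{(m-1)/2}+1$. (2.2) $\mathcal{C}_S^\perp$ and $\mathcal{C}_{S'}^\perp$ form a pair of even-like duadic codes, both with parameters $[2^m-1,2^{m-1}-1,d^\perp]$, where $d^\perp\ge 2^{(m-1)/2}+2$. (2.3) $\overline{\mathcal{C}_S}$ and $\overline{\mathcal{C}_{S'}}$ are self-dual and doubly-even, and both have parameters $[2^m,2^{m-1},\overline d]$, where $\overline d\ge 2^{(m-1)/2}+4$ if $m\ne 3$. -/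

import Mathlib

open Polynomial

/-- The polynomial `c₀ + c₁ X + ⋯ + c_{n-1} X^(n-1)` of a binary vector of length `n`. -/
noncomputable def codePoly (n : ℕ) : (Fin n → ZMod 2) →ₗ[ZMod 2] (ZMod 2)[X] :=
  ∑ i : Fin n, (Polynomial.monomial (i : ℕ)) ∘ₗ (LinearMap.proj i)

/-- The binary cyclic code of length `n` generated by `g`: the vectors whose polynomial is, modulo
`X ^ n - 1`, a multiple of `g`. -/
noncomputable def cyclicCode (n : ℕ) (g : (ZMod 2)[X]) : Submodule (ZMod 2) (Fin n → ZMod 2) :=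
  Submodule.comap (codePoly n)
    ((Ideal.span {g, X ^ n - 1} : Ideal (ZMod 2)[X]).restrictScalars (ZMod 2))

/-- `g` is the generator polynomial of the code `C` of length `n`. -/
def IsGeneratorPoly {n : ℕ} (C : Submodule (ZMod 2) (Fin n → ZMod 2)) (g : (ZMod 2)[X]) : Prop :=
  g.Monic ∧ g ∣ X ^ n - 1 ∧ C = cyclicCode n g

/-- `C` is a cyclic code of length `n` whose defining set relative to the `n`-th root of unity `β`
is `T`: the exponents `i` modulo `n` with `g(β ^ i) = 0`, for `g` the generator polynomial. -/
def HasDefiningSet {K : Type*} [Field K] [Algebra (ZMod 2) K] {n : ℕ} (β : K)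
    (C : Submodule (ZMod 2) (Fin n → ZMod 2)) (T : Set (ZMod n)) : Prop :=
  ∃ g : (ZMod 2)[X], IsGeneratorPoly C g ∧
    ∀ i : ZMod n, i ∈ T ↔ Polynomial.aeval (β ^ i.val) g = 0

/-- The 2-cyclotomic coset of `s` modulo `n`. -/
def cyclotomicCoset (n : ℕ) (s : ZMod n) : Set (ZMod n) :=
  {x | ∃ t : ℕ, x = s * 2 ^ t}

/-- `S` is a union of 2-cyclotomic cosets modulo `n`. -/
def IsUnionOfCosets {n : ℕ} (S : Set (ZMod n)) : Prop :=
  ∃ A : Set (ZMod n), S = ⋃ s ∈ A, cyclotomicCoset n s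

/-- `(S₁, S₂, μ)` is a splitting of `ℤ/n` (into unions of 2-cyclotomic cosets). -/
def IsSplitting {n : ℕ} (S₁ S₂ : Set (ZMod n)) (μ : (ZMod n)ˣ) : Prop :=
  IsUnionOfCosets S₁ ∧ IsUnionOfCosets S₂ ∧
  S₁ ∪ S₂ = Set.univ \ {0} ∧ S₁ ∩ S₂ = ∅ ∧
  (fun i => i * (μ : ZMod n)) '' S₁ = S₂ ∧ (fun i => i * (μ : ZMod n)) '' S₂ = S₁

/-- `C₁` and `C₂` form a pair of odd-like binary duadic codes of length `n`
(defining sets being taken relative to `β`). -/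
def IsOddLikeDuadicPair {K : Type*} [Field K] [Algebra (ZMod 2) K] {n : ℕ} (β : K)
    (C₁ C₂ : Submodule (ZMod 2) (Fin n → ZMod 2)) : Prop :=
  ∃ (S₁ S₂ : Set (ZMod n)) (μ : (ZMod n)ˣ), IsSplitting S₁ S₂ μ ∧
    HasDefiningSet β C₁ S₁ ∧ HasDefiningSet β C₂ S₂

/-- `C₁` and `C₂` form a pair of even-like binary duadic codes of length `n`
(defining sets being taken relative to `β`). -/
def IsEvenLikeDuadicPair {K : Type*} [Field K] [Algebra (ZMod 2) K] {n : ℕ} (β : K)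
    (C₁ C₂ : Submodule (ZMod 2) (Fin n → ZMod 2)) : Prop :=
  ∃ (S₁ S₂ : Set (ZMod n)) (μ : (ZMod n)ˣ), IsSplitting S₁ S₂ μ ∧
    HasDefiningSet β C₁ ({0} ∪ S₁) ∧ HasDefiningSet β C₂ ({0} ∪ S₂)

/-- The binary linear code `C` has parameters `[N, k, d]`: length `N`, dimension `k` and minimum
distance (exactly) `d`. -/
def HasParameters {ι : Type*} [Fintype ι] (C : Submodule (ZMod 2) (ι → ZMod 2))
    (N k d : ℕ) : Prop :=
  Fintype.card ι = N ∧ Module.finrank (ZMod 2) C = k ∧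
    IsLeast {w : ℕ | ∃ x ∈ C, ∃ y ∈ C, x ≠ y ∧ hammingDist x y = w} d

/-- The dual code with respect to the standard bilinear form. -/
def dualCode {ι : Type*} [Fintype ι] (C : Submodule (ZMod 2) (ι → ZMod 2)) :
    Submodule (ZMod 2) (ι → ZMod 2) where
  carrier := {x | ∀ c ∈ C, x ⬝ᵥ c = 0}
  zero_mem' := fun c _ => zero_dotProduct c
  add_mem' := fun {a b} ha hb c hc => by rw [add_dotProduct, ha c hc, hb c hc, add_zero]
  smul_mem' := fun t a ha c hc => by rw [smul_dotProduct, ha c hc, smul_zero]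

/-- The extended code: codewords of `C` followed by an overall parity coordinate. -/
def extendedCode {n : ℕ} (C : Submodule (ZMod 2) (Fin n → ZMod 2)) :
    Submodule (ZMod 2) (Fin (n + 1) → ZMod 2) where
  carrier := {c | (fun i : Fin n => c i.castSucc) ∈ C ∧ ∑ i, c i = 0}
  zero_mem' := ⟨C.zero_mem, by simp⟩
  add_mem' := fun {a b} ha hb =>
    ⟨C.add_mem ha.1 hb.1, by
      simp only [Pi.add_apply, Finset.sum_add_distrib, ha.2, hb.2, add_zero]⟩
  smul_mem' := fun t a ha =>
    ⟨C.smul_mem t ha.1, by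
      simp only [Pi.smul_apply, ← Finset.smul_sum, ha.2, smul_zero]⟩

/-- A code is self-dual if it is equal to its dual. -/
def IsSelfDual {ι : Type*} [Fintype ι] (C : Submodule (ZMod 2) (ι → ZMod 2)) : Prop :=
  dualCode C = C

/-- A binary code is doubly-even if all its weights are divisible by `4`. -/
def IsDoublyEven {ι : Type*} [Fintype ι] (C : Submodule (ZMod 2) (ι → ZMod 2)) : Prop :=
  ∀ c ∈ C, 4 ∣ hammingNorm c

/-- The 2-weight: the sum of the binary digits of `j`. -/
def w2 (j : ℕ) : ℕ := (Nat.digits 2 j).sum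

/-- The set of all `1 ≤ j ≤ 2^m - 2` with `w2 j` modulo `r` in `S`. -/
def weightSet (r m : ℕ) (S : Finset (ZMod r)) : Finset ℕ :=
  (Finset.Icc 1 (2 ^ m - 2)).filter fun j => (w2 j : ZMod r) ∈ S

theorem w2_two_mul (j : ℕ) : w2 (2 * j) = w2 j := by
  rcases Nat.eq_zero_or_pos j with rfl | hj
  · rfl
  · unfold w2
    rw [Nat.digits_def' (by norm_num) (by omega)]
    simp

theorem w2_two_mul_add_one (j : ℕ) : w2 (2 * j + 1) = w2 j + 1 := by
  unfold w2
  rw [Nat.digits_def' (by norm_num) (by omega)]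
  have h1 : (2 * j + 1) % 2 = 1 := by omega
  have h2 : (2 * j + 1) / 2 = j := by omega
  rw [h1, h2, List.sum_cons, add_comm]

theorem w2_two_pow_add (k j : ℕ) (hj : j < 2 ^ k) : w2 (2 ^ k + j) = w2 j + 1 := by
  induction k generalizing j with
  | zero =>
    obtain rfl : j = 0 := by simpa using hj
    simp [w2]
  | succ k ih =>
    have hp : 2 ^ (k + 1) = 2 * 2 ^ k := by ring
    rcases Nat.even_or_odd' j with ⟨i, rfl | rfl⟩
    · rw [hp, ← mul_add, w2_two_mul, w2_two_mul, ih i (by omega)]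
    · rw [hp, ← add_assoc, ← mul_add, w2_two_mul_add_one, w2_two_mul_add_one, ih i (by omega)]

/-- Doubling modulo `2 ^ m - 1` maps `weightSet r m S` to itself. -/
theorem two_mul_mod_mem_weightSet (r m : ℕ) (S : Finset (ZMod r)) (j : ℕ)
    (hj : j ∈ weightSet r m S) : (2 * j) % (2 ^ m - 1) ∈ weightSet r m S := by
  obtain ⟨hj1, hj2⟩ := Finset.mem_filter.1 hj
  rw [Finset.mem_Icc] at hj1
  obtain ⟨k, rfl⟩ : ∃ k, m = k + 1 := by
    rcases m with _ | k
    · simp at hj1; omega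
    · exact ⟨k, rfl⟩
  have hp : 2 ^ (k + 1) = 2 * 2 ^ k := by ring
  rw [weightSet, Finset.mem_filter, Finset.mem_Icc]
  rcases lt_or_ge j (2 ^ k) with h | h
  · have h2 : (2 * j) % (2 ^ (k + 1) - 1) = 2 * j := Nat.mod_eq_of_lt (by omega)
    rw [h2, w2_two_mul]
    exact ⟨by omega, hj2⟩
  · obtain ⟨i, rfl⟩ := Nat.exists_eq_add_of_le h
    have h2 : (2 * (2 ^ k + i)) % (2 ^ (k + 1) - 1) = 2 * i + 1 := by
      rw [show 2 * (2 ^ k + i) = (2 * i + 1) + (2 ^ (k + 1) - 1) by omega, Nat.add_mod_right]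
      exact Nat.mod_eq_of_lt (by omega)
    rw [h2, w2_two_mul_add_one, ← w2_two_pow_add k i (by omega)]
    exact ⟨by omega, hj2⟩

/-- The product of all `X - α ^ i`, `i ∈ weightSet r m S`, has its coefficients in `𝔽₂`. -/
theorem exists_generator {K : Type*} [Field K] [Algebra (ZMod 2) K] (r : ℕ) {m : ℕ}
    (hK : Nat.card K = 2 ^ m) (α : Kˣ) (S : Finset (ZMod r)) :
    ∃ g : (ZMod 2)[X], g.map (algebraMap (ZMod 2) K) =
      ∏ i ∈ weightSet r m S, (X - C ((α : K) ^ i)) := by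
  have hchar : CharP K 2 := charP_of_injective_algebraMap (algebraMap (ZMod 2) K).injective 2
  have hfin : Finite K := Nat.finite_of_card_ne_zero (by rw [hK]; positivity)
  have hα : (α : K) ^ (2 ^ m - 1) = 1 := by
    rw [← hK, ← Nat.card_units, ← Units.val_pow_eq_pow_val, pow_card_eq_one', Units.val_one]
  have hinj : Set.InjOn (fun j => (2 * j) % (2 ^ m - 1)) (weightSet r m S) := by
    intro a ha b hb hab
    have ha' := Finset.mem_Icc.1 (Finset.mem_filter.1 ha).1
    have hb' := Finset.mem_Icc.1 (Finset.mem_filter.1 hb).1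
    have hm : m ≠ 0 := by rintro rfl; simp at ha'; omega
    have hodd : Nat.Coprime (2 ^ m - 1) 2 := by
      rw [Nat.coprime_two_right, Nat.odd_iff]
      have : 2 ∣ 2 ^ m := dvd_pow_self 2 hm
      omega
    have h : a ≡ b [MOD 2 ^ m - 1] := Nat.ModEq.cancel_left_of_coprime hodd hab
    have := Nat.mod_eq_of_lt (a := a) (b := 2 ^ m - 1) (by omega)
    have := Nat.mod_eq_of_lt (a := b) (b := 2 ^ m - 1) (by omega)
    unfold Nat.ModEq at h
    omega
  have himg : (weightSet r m S).image (fun j => (2 * j) % (2 ^ m - 1)) = weightSet r m S := by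
    apply Finset.eq_of_subset_of_card_le
    · intro x hx
      obtain ⟨j, hj, rfl⟩ := Finset.mem_image.1 hx
      exact two_mul_mod_mem_weightSet r m S j hj
    · rw [Finset.card_image_of_injOn hinj]
  have hfix : (∏ i ∈ weightSet r m S, (X - C ((α : K) ^ i))).map (frobenius K 2) =
      ∏ i ∈ weightSet r m S, (X - C ((α : K) ^ i)) := by
    rw [Polynomial.map_prod]
    conv_rhs => rw [← himg, Finset.prod_image hinj]
    refine Finset.prod_congr rfl fun i _ => ?_
    rw [Polynomial.map_sub, Polynomial.map_X, Polynomial.map_C, frobenius_def, ← pow_mul,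
      mul_comm i 2, ← pow_eq_pow_mod _ hα]
  have hl : (∏ i ∈ weightSet r m S, (X - C ((α : K) ^ i))) ∈
      Polynomial.lifts (algebraMap (ZMod 2) K) := by
    rw [Polynomial.lifts_iff_coeff_lifts]
    intro k
    have hk := congrArg (fun p => Polynomial.coeff p k) hfix
    simp only [Polynomial.coeff_map, frobenius_def] at hk
    set a := (∏ i ∈ weightSet r m S, (X - C ((α : K) ^ i))).coeff k
    have : a * (a - 1) = 0 := by linear_combination hk
    rcases mul_eq_zero.1 this with h | h
    · exact ⟨0, by rw [h, map_zero]⟩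
    · exact ⟨1, by rw [sub_eq_zero.1 h, map_one]⟩
  exact (Polynomial.mem_lifts _).1 hl

/-- The polynomial over `𝔽₂` that is equal, over the field `K` with `2 ^ m` elements, to the product
of all `X - α ^ i` with `i ∈ weightSet r m S`. -/
noncomputable def weightGenerator {K : Type*} [Field K] [Algebra (ZMod 2) K] (r : ℕ) {m : ℕ}
    (hK : Nat.card K = 2 ^ m) (α : Kˣ) (S : Finset (ZMod r)) : (ZMod 2)[X] :=
  Classical.choose (exists_generator r hK α S)

theorem weightGenerator_map {K : Type*} [Field K] [Algebra (ZMod 2) K] (r : ℕ) {m : ℕ}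
    (hK : Nat.card K = 2 ^ m) (α : Kˣ) (S : Finset (ZMod r)) :
    (weightGenerator r hK α S).map (algebraMap (ZMod 2) K) =
      ∏ i ∈ weightSet r m S, (X - C ((α : K) ^ i)) :=
  Classical.choose_spec (exists_generator r hK α S)

/-- The binary cyclic code of length `2 ^ m - 1` with generator polynomial
`∏ (X - α ^ i)`, `i` running over `weightSet r m S`. -/
noncomputable def weightCode {K : Type*} [Field K] [Algebra (ZMod 2) K] (r : ℕ) {m : ℕ}
    (hK : Nat.card K = 2 ^ m) (α : Kˣ) (S : Finset (ZMod r)) :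
    Submodule (ZMod 2) (Fin (2 ^ m - 1) → ZMod 2) :=
  cyclicCode (2 ^ m - 1) (weightGenerator r hK α S)

/-! Write n = 2^m - 1 and m = 2h + 1. Each listed S satisfies: s ∈ S iff 3 - s ∉ S, and m = 3 in
ℤ/8. Replacing j by n - j flips all m binary digits, so exactly one of j and n - j lies in T_S for 0
< j < n. All conclusions rest on this symmetry.

Duality: the multiplier -1 interchanges T_S and T_{S'}, and reversing coordinates carries one code
to the other. By Parseval (`natCast_sum_eq_dotProduct`) only frequency 0 contributes to the inner
product of two codewords, which is therefore the product of their parities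
(`dotProduct_of_mem_weightCode`). Hence the dual is the even-weight subcode and the extended code is
self-dual.

Weights mod 4: all shifts of a codeword are codewords, so every cyclic autocorrelation of its
support has the parity of its weight. Counting pairs of support points mod 4 with n ≡ 3 (mod 4)
forces weight 0 or 3 mod 4 (`card_add_mod_two_mod_four`).

Distance: the numbers (2^h - 1)j with 1 ≤ j ≤ 2^h all have 2-weight h, and 2^h - 1 is prime to n. So
α^(2^h - 1) or its inverse is a primitive root with 2^h consecutive powers as zeros, and BCH gives d
≥ 2^h + 1. An even word also has frequency 0, hence weight at least 2^h + 2. If h ≥ 2, then 4 ∣ 2^h,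
and the weights mod 4 raise these bounds to 2^h + 3 and 2^h + 4. -/

/-! ### Cyclic codes as sets of polynomials -/

theorem codePoly_apply {n : ℕ} (c : Fin n → ZMod 2) :
    codePoly n c = ∑ k : Fin n, Polynomial.monomial (k : ℕ) (c k) := by
  simp [codePoly, LinearMap.sum_apply]

theorem coeff_codePoly {n : ℕ} (c : Fin n → ZMod 2) (k : Fin n) :
    (codePoly n c).coeff k = c k := by
  simp [codePoly_apply, Polynomial.finsetSum_coeff, Polynomial.coeff_monomial, Fin.val_inj]

theorem codePoly_injective (n : ℕ) : Function.Injective (codePoly n) := fun a b h => by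
  ext k
  rw [← coeff_codePoly a, h, coeff_codePoly]

theorem codePoly_degree_lt {n : ℕ} (c : Fin n → ZMod 2) : (codePoly n c).degree < n := by
  rw [codePoly_apply, ← Polynomial.mem_degreeLT]
  refine Submodule.sum_mem _ fun k _ => ?_
  rw [Polynomial.mem_degreeLT]
  exact (Polynomial.degree_monomial_le _ _).trans_lt (by exact_mod_cast k.2)

theorem codePoly_coeff {n : ℕ} {p : (ZMod 2)[X]} (hp : p.degree < n) :
    codePoly n (fun k => p.coeff k) = p := by
  ext j
  by_cases hj : j < n
  · exact coeff_codePoly _ ⟨j, hj⟩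
  · have hn : (n : WithBot ℕ) ≤ (j : WithBot ℕ) := by exact_mod_cast not_lt.1 hj
    rw [Polynomial.coeff_eq_zero_of_degree_lt (hp.trans_le hn),
      Polynomial.coeff_eq_zero_of_degree_lt ((codePoly_degree_lt _).trans_le hn)]

theorem mem_cyclicCode_iff_dvd {n : ℕ} {g : (ZMod 2)[X]} (hg : g ∣ X ^ n - 1)
    (c : Fin n → ZMod 2) : c ∈ cyclicCode n g ↔ g ∣ codePoly n c := by
  have h : (Ideal.span {g, X ^ n - 1} : Ideal (ZMod 2)[X]) = Ideal.span {g} := by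
    refine le_antisymm ?_ (Ideal.span_mono (by simp))
    rw [Ideal.span_le]
    rintro x (rfl | rfl)
    · exact Ideal.mem_span_singleton_self _
    · exact Ideal.mem_span_singleton.2 hg
  rw [cyclicCode, Submodule.mem_comap, Submodule.restrictScalars_mem, h,
    Ideal.mem_span_singleton]

/-- Multiplication by g identifies the polynomials of degree below n - deg g with the code. -/
theorem finrank_cyclicCode {n : ℕ} (hn : n ≠ 0) {g : (ZMod 2)[X]} (hg : g ∣ X ^ n - 1) :
    Module.finrank (ZMod 2) (cyclicCode n g) = n - g.natDegree := by
  have hX : (X ^ n - 1 : (ZMod 2)[X]) ≠ 0 := (Polynomial.monic_X_pow_sub_C 1 hn).ne_zero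
  have hg0 : g ≠ 0 := ne_zero_of_dvd_ne_zero hX hg
  have hd : g.natDegree ≤ n := by
    have := Polynomial.natDegree_le_of_dvd hg hX
    rwa [show (X ^ n - 1 : (ZMod 2)[X]) = X ^ n - C 1 by simp,
      Polynomial.natDegree_X_pow_sub_C] at this
  have hdeg : ∀ q : (ZMod 2)[X], (g * q).degree < n ↔ q.degree < ((n - g.natDegree : ℕ)) := by
    intro q
    by_cases hq : q = 0
    · simp [hq]
    rw [Polynomial.degree_mul, Polynomial.degree_eq_natDegree hg0,
      Polynomial.degree_eq_natDegree hq]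
    norm_cast
    omega
  let φ : (Fin (n - g.natDegree) → ZMod 2) →ₗ[ZMod 2] (Fin n → ZMod 2) :=
    (LinearMap.pi fun k : Fin n => Polynomial.lcoeff (ZMod 2) (k : ℕ)) ∘ₗ
      LinearMap.mulLeft (ZMod 2) g ∘ₗ codePoly (n - g.natDegree)
  have hφ : ∀ u, codePoly n (φ u) = g * codePoly _ u := fun u =>
    codePoly_coeff ((hdeg _).2 (codePoly_degree_lt u))
  have hinj : Function.Injective φ := fun u v huv => by
    apply codePoly_injective
    apply mul_left_cancel₀ hg0
    rw [← hφ, huv, hφ]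
  have hrange : LinearMap.range φ = cyclicCode n g := by
    ext c
    rw [mem_cyclicCode_iff_dvd hg]
    constructor
    · rintro ⟨u, rfl⟩
      exact hφ u ▸ dvd_mul_right _ _
    · rintro ⟨q, hq⟩
      refine ⟨fun k => q.coeff k, codePoly_injective n ?_⟩
      rw [hφ, codePoly_coeff, hq]
      rw [← hdeg, ← hq]
      exact codePoly_degree_lt c
  rw [← hrange, LinearMap.finrank_range_of_inj hinj, Module.finrank_fin_fun]

/-! ### Cyclic codes described by their zeros -/

section roots

variable {K : Type*} [Field K] [Algebra (ZMod 2) K] {n : ℕ} {α : K} {T : Finset ℕ}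
  {g : (ZMod 2)[X]}

theorem aeval_codePoly (β : K) (c : Fin n → ZMod 2) :
    aeval β (codePoly n c) = ∑ k : Fin n, algebraMap (ZMod 2) K (c k) * β ^ (k : ℕ) := by
  rw [codePoly_apply, map_sum]
  exact Finset.sum_congr rfl fun k _ => Polynomial.aeval_monomial _

theorem aeval_eq_zero_iff_of_map_eq_prod
    (hg : g.map (algebraMap (ZMod 2) K) = ∏ i ∈ T, (X - C (α ^ i))) (x : K) :
    aeval x g = 0 ↔ ∃ i ∈ T, x = α ^ i := by
  rw [← Polynomial.eval_map_algebraMap, hg, Polynomial.eval_prod, Finset.prod_eq_zero_iff]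
  simp [sub_eq_zero]

/-- Exponents below n give distinct powers of α, so the linear factors are coprime; divisibility
over K descends to 𝔽₂. -/
theorem dvd_iff_of_map_eq_prod (hα : IsPrimitiveRoot α n) (hT : ∀ i ∈ T, i < n)
    (hg : g.map (algebraMap (ZMod 2) K) = ∏ i ∈ T, (X - C (α ^ i))) (p : (ZMod 2)[X]) :
    g ∣ p ↔ ∀ i ∈ T, aeval (α ^ i) p = 0 := by
  constructor
  · rintro ⟨q, rfl⟩ i hi
    rw [map_mul, (aeval_eq_zero_iff_of_map_eq_prod hg _).2 ⟨i, hi, rfl⟩, zero_mul]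
  · intro h
    rw [← Polynomial.map_dvd_map' (algebraMap (ZMod 2) K), hg]
    refine Finset.prod_dvd_of_coprime ?_ fun i hi => ?_
    · intro i hi j hj hij
      refine Polynomial.isCoprime_X_sub_C_of_isUnit_sub (sub_ne_zero.2 fun h => hij ?_).isUnit
      exact hα.pow_inj (hT i hi) (hT j hj) h
    · rw [Polynomial.dvd_iff_isRoot, Polynomial.IsRoot.def, Polynomial.eval_map_algebraMap]
      exact h i hi

theorem dvd_X_pow_sub_one_of_map_eq_prod (hα : IsPrimitiveRoot α n) (hT : ∀ i ∈ T, i < n)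
    (hg : g.map (algebraMap (ZMod 2) K) = ∏ i ∈ T, (X - C (α ^ i))) : g ∣ X ^ n - 1 := by
  refine (dvd_iff_of_map_eq_prod hα hT hg _).2 fun i _ => ?_
  rw [map_sub, map_pow, aeval_X, map_one, ← pow_mul, mul_comm, pow_mul, hα.pow_eq_one, one_pow,
    sub_self]

theorem mem_cyclicCode_iff_aeval (hα : IsPrimitiveRoot α n) (hT : ∀ i ∈ T, i < n)
    (hg : g.map (algebraMap (ZMod 2) K) = ∏ i ∈ T, (X - C (α ^ i))) (c : Fin n → ZMod 2) :
    c ∈ cyclicCode n g ↔ ∀ i ∈ T, aeval (α ^ i) (codePoly n c) = 0 := by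
  rw [mem_cyclicCode_iff_dvd (dvd_X_pow_sub_one_of_map_eq_prod hα hT hg),
    dvd_iff_of_map_eq_prod hα hT hg]

theorem finrank_cyclicCode_of_map_eq_prod (hn : n ≠ 0) (hα : IsPrimitiveRoot α n)
    (hT : ∀ i ∈ T, i < n)
    (hg : g.map (algebraMap (ZMod 2) K) = ∏ i ∈ T, (X - C (α ^ i))) :
    Module.finrank (ZMod 2) (cyclicCode n g) = n - T.card := by
  rw [finrank_cyclicCode hn (dvd_X_pow_sub_one_of_map_eq_prod hα hT hg),
    ← Polynomial.natDegree_map (algebraMap (ZMod 2) K), hg,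
    Polynomial.natDegree_finsetProd_X_sub_C_eq_card]

theorem hasDefiningSet_of_map_eq_prod [NeZero n] (hα : IsPrimitiveRoot α n)
    (hT : ∀ i ∈ T, i < n)
    (hg : g.map (algebraMap (ZMod 2) K) = ∏ i ∈ T, (X - C (α ^ i))) :
    HasDefiningSet α (cyclicCode n g) {i : ZMod n | i.val ∈ T} := by
  refine ⟨g, ⟨?_, dvd_X_pow_sub_one_of_map_eq_prod hα hT hg, rfl⟩, fun i => ?_⟩
  · rw [← Polynomial.monic_map_iff (f := algebraMap (ZMod 2) K), hg]
    exact Polynomial.monic_prod_of_monic _ _ fun i _ => Polynomial.monic_X_sub_C _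
  · rw [aeval_eq_zero_iff_of_map_eq_prod hg]
    constructor
    · exact fun h => ⟨_, h, rfl⟩
    · rintro ⟨j, hj, hij⟩
      rwa [Set.mem_ofPred_eq, hα.pow_inj i.val_lt (hT j hj) hij]

end roots

/-! ### Dimension of the dual code -/

theorem finrank_dualCode_add {ι : Type*} [Fintype ι] (C : Submodule (ZMod 2) (ι → ZMod 2)) :
    Module.finrank (ZMod 2) C + Module.finrank (ZMod 2) (dualCode C) = Fintype.card ι := by
  classical
  have h : (dualCode C).map (dotProductEquiv (ZMod 2) ι : _ →ₗ[ZMod 2] _) = C.dualAnnihilator := by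
    ext f
    rw [Submodule.mem_dualAnnihilator, Submodule.mem_map]
    constructor
    · rintro ⟨x, hx, rfl⟩ c hc
      exact hx c hc
    · intro hf
      refine ⟨(dotProductEquiv (ZMod 2) ι).symm f, fun c hc => ?_, by simp⟩
      rw [← hf c hc, ← dotProductEquiv_apply_apply, LinearEquiv.apply_symm_apply]
  have h2 := Subspace.finrank_add_finrank_dualAnnihilator_eq C
  rw [← h, LinearEquiv.finrank_map_eq, Module.finrank_fintype_fun_eq_card] at h2
  exact h2

/-- Orthogonality gives one inclusion, and complementary dimensions turn it into equality. -/
theorem dualCode_eq_of_le {ι : Type*} [Fintype ι] {C D : Submodule (ZMod 2) (ι → ZMod 2)}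
    (h : ∀ x ∈ D, ∀ c ∈ C, x ⬝ᵥ c = 0)
    (hr : Module.finrank (ZMod 2) C + Module.finrank (ZMod 2) D = Fintype.card ι) :
    dualCode C = D := by
  have h1 := finrank_dualCode_add C
  exact (Submodule.eq_of_le_of_finrank_eq (show D ≤ dualCode C from fun x hx => h x hx)
    (by omega)).symm

/-! ### Autocorrelations of a subset, modulo 4 -/

section finiteGroup

variable {G : Type*} [AddCommGroup G] [DecidableEq G]

theorem card_filter_add_neg_mem (A : Finset G) (s : G) :
    (A.filter fun k => k + -s ∈ A).card = (A.filter fun k => k + s ∈ A).card := by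
  refine Finset.card_nbij' (fun k => k + -s) (fun k => k + s) ?_ ?_ ?_ ?_ <;>
    intro k <;> simp +contextual

variable [Fintype G]

/-- Every ordered pair of points of A is counted once, at the s equal to its difference. -/
theorem sum_card_filter_add_mem (A : Finset G) :
    ∑ s : G, (A.filter fun k => k + s ∈ A).card = A.card * A.card := by
  simp_rw [Finset.card_filter]
  rw [Finset.sum_comm]
  have h : ∀ k ∈ A, (∑ s : G, if k + s ∈ A then 1 else 0) = A.card := fun k _ => by
    have := Fintype.sum_equiv (Equiv.addLeft k) (fun s => if k + s ∈ A then 1 else 0)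
      (fun s => if s ∈ A then 1 else 0) (fun s => rfl)
    rw [this]
    simp
  rw [Finset.sum_congr rfl h, Finset.sum_const, smul_eq_mul]

/-- If all autocorrelations of a subset of a group of order `3` modulo `4` have the same parity as
the subset, then the size of the subset is `0` or `3` modulo `4`. -/
theorem card_add_mod_two_mod_four (hG : Fintype.card G % 4 = 3) (A : Finset G)
    (h : ∀ s, (A.filter fun k => k + s ∈ A).card % 2 = A.card % 2) :
    4 ∣ A.card + A.card % 2 := by
  set N : G → ℕ := fun s => (A.filter fun k => k + s ∈ A).card with hN
  set e := A.card % 2 with he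
  -- N s and e have equal parity, so their difference is killed by 2 in `ZMod 4`; the terms at s and
  -- -s, being equal, will cancel.
  have hf : ∀ s, ((N s : ZMod 4) - e) + ((N s : ZMod 4) - e) = 0 := fun s => by
    have h1 : N s = 2 * (N s / 2) + e := by have := h s; simp only [hN]; omega
    rw [h1]
    push_cast
    have h4 : (4 : ZMod 4) = 0 := rfl
    linear_combination ((N s / 2 : ℕ) : ZMod 4) * h4
  have hsum : ∑ s ∈ Finset.univ.erase (0 : G), ((N s : ZMod 4) - e) = 0 := by
    refine Finset.sum_involution (fun s _ => -s) (fun s _ => ?_) (fun s hs _ hss => ?_) ?_ ?_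
    · rw [show N (-s) = N s from card_filter_add_neg_mem A s, hf]
    -- A fixed point of negation has order dividing 2; the group order is odd, so s = 0, which was
    -- removed.
    · have h2 : 2 • s = 0 := by rw [two_smul]; nth_rewrite 1 [← hss]; simp
      have h3 := addOrderOf_dvd_card (x := s)
      have h4 := addOrderOf_dvd_of_nsmul_eq_zero h2
      have h5 : addOrderOf s = 1 := by
        rcases (Nat.dvd_prime Nat.prime_two).1 h4 with h5 | h5
        · exact h5
        · rw [h5] at h3; omega
      exact (Finset.mem_erase.1 hs).1 (AddMonoid.addOrderOf_eq_one_iff.1 h5)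
    · simp
    · simp
  have hN0 : N 0 = A.card := by simp [hN]
  have htot : ∑ s, (N s : ZMod 4) = A.card * A.card := by
    exact_mod_cast congrArg (Nat.cast (R := ZMod 4)) (sum_card_filter_add_mem A)
  rw [Finset.sum_erase_eq_sub (Finset.mem_univ _), Finset.sum_sub_distrib, htot, hN0,
    Finset.sum_const, Finset.card_univ, nsmul_eq_mul] at hsum
  have hc : ((Fintype.card G : ℕ) : ZMod 4) = 3 := by
    exact (ZMod.natCast_eq_natCast_iff _ 3 4).2 hG
  rw [hc] at hsum
  rw [← ZMod.natCast_eq_zero_iff]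
  have hA : A.card = 4 * (A.card / 4) + A.card % 4 := by omega
  have hA' : (A.card : ZMod 4) = ((A.card % 4 : ℕ) : ZMod 4) := by simp
  rw [Nat.cast_add, he]
  rw [he] at hsum
  rw [hA'] at hsum ⊢
  have h42 : A.card % 2 = (A.card % 4) % 2 := by omega
  rw [h42] at hsum ⊢
  have hlt : A.card % 4 < 4 := Nat.mod_lt _ (by norm_num)
  generalize A.card % 4 = r at *
  clear * - hsum hlt
  revert hsum
  -- With a the size of A, what remains is a² - a - 2e = 0 mod 4, which excludes the residues 1 and
  -- 2.
  interval_cases r <;> decide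

end finiteGroup

/-! ### Fourier transform of a word and the BCH bound -/

section spectrum

variable {K : Type*} [Field K] {n : ℕ} {α : K}

theorem pow_val_add [NeZero n] {β : K} (hβ : β ^ n = 1) (k s : Fin n) :
    β ^ ((k + s : Fin n) : ℕ) = β ^ (k : ℕ) * β ^ (s : ℕ) := by
  rw [Fin.val_add, ← pow_eq_pow_mod _ hβ, pow_add]

variable [Algebra (ZMod 2) K]

/-- Parseval's identity: expanding both transforms, orthogonality of the characters k ↦ α^(ik) keeps
only the diagonal terms. -/
theorem natCast_sum_eq_dotProduct (hα : IsPrimitiveRoot α n) (c d : Fin n → ZMod 2) :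
    ∑ i ∈ Finset.range n, aeval (α ^ i) (codePoly n c) * aeval (α ^ i)⁻¹ (codePoly n d) =
      n * algebraMap (ZMod 2) K (c ⬝ᵥ d) := by
  rcases Nat.eq_zero_or_pos n with rfl | hn
  · simp
  have hα0 : α ≠ 0 := hα.ne_zero hn.ne'
  have hgeom : ∀ k l : Fin n, ∑ i ∈ Finset.range n, (α ^ (k : ℕ) * (α ^ (l : ℕ))⁻¹) ^ i =
      if k = l then (n : K) else 0 := fun k l => by
    split_ifs with hkl
    · subst hkl
      simp [mul_inv_cancel₀ (pow_ne_zero _ hα0)]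
    -- For k ≠ l the ratio is an n-th root of unity other than 1, so its geometric sum vanishes.
    · have h1 : α ^ (k : ℕ) * (α ^ (l : ℕ))⁻¹ - 1 ≠ 0 := by
        rw [sub_ne_zero, ← div_eq_mul_inv]
        intro h
        exact hkl (Fin.ext (hα.pow_inj k.2 l.2 ((div_eq_one_iff_eq (pow_ne_zero _ hα0)).1 h)))
      refine (mul_eq_zero.1 ?_).resolve_right h1
      rw [geom_sum_mul, mul_pow, inv_pow, ← pow_mul, ← pow_mul, mul_comm _ n, mul_comm _ n, pow_mul,
        pow_mul, hα.pow_eq_one]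
      simp
  simp_rw [aeval_codePoly, Finset.sum_mul_sum]
  rw [Finset.sum_comm]
  simp_rw [Finset.sum_comm (s := Finset.range n)]
  have : ∀ k l : Fin n, ∑ i ∈ Finset.range n,
      algebraMap (ZMod 2) K (c k) * (α ^ i) ^ (k : ℕ) *
        (algebraMap (ZMod 2) K (d l) * (α ^ i)⁻¹ ^ (l : ℕ)) =
      if k = l then n * algebraMap (ZMod 2) K (c k * d l) else 0 := fun k l => by
    have h := congrArg (fun x => algebraMap (ZMod 2) K (c k * d l) * x) (hgeom k l)
    simp only [Finset.mul_sum, mul_ite, mul_zero] at h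
    rw [mul_comm (n : K), ← h]
    refine Finset.sum_congr rfl fun i _ => ?_
    rw [map_mul, mul_pow, inv_pow, inv_pow, ← pow_mul, ← pow_mul, ← pow_mul, ← pow_mul,
      mul_comm i, mul_comm i]
    ring
  simp_rw [this]
  simp [dotProduct, Finset.mul_sum]

theorem aeval_one_codePoly (c : Fin n → ZMod 2) :
    aeval (1 : K) (codePoly n c) = algebraMap (ZMod 2) K (∑ k, c k) := by
  simp [aeval_codePoly]

/-- If no frequency other than `0` is present in `c` and, with opposite sign, in `d`, then the
inner product of `c` and `d` is the product of their parities. -/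
theorem dotProduct_eq_sum_mul_sum (hα : IsPrimitiveRoot α n) (hn : Odd n) {c d : Fin n → ZMod 2}
    (h : ∀ i, 0 < i → i < n →
      aeval (α ^ i) (codePoly n c) = 0 ∨ aeval (α ^ i)⁻¹ (codePoly n d) = 0) :
    c ⬝ᵥ d = (∑ k, c k) * ∑ k, d k := by
  have hsum := natCast_sum_eq_dotProduct hα c d
  rw [Finset.sum_eq_single_of_mem 0 (Finset.mem_range.2 hn.pos)] at hsum
  · apply (algebraMap (ZMod 2) K).injective
    have h1 : (n : K) = 1 := by
      have : (n : ZMod 2) = 1 := (ZMod.natCast_eq_one_iff_odd).2 hn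
      rw [← map_natCast (algebraMap (ZMod 2) K), this, map_one]
    rw [h1, one_mul] at hsum
    rw [← hsum, pow_zero, inv_one, aeval_one_codePoly, aeval_one_codePoly, map_mul]
  · intro i hi hi0
    rcases h i (Nat.pos_of_ne_zero hi0) (Finset.mem_range.1 hi) with h | h <;> simp [h]

/-- A shift only multiplies each frequency by a nonzero factor, so it preserves the zeros. -/
theorem aeval_codePoly_shift [NeZero n] {β : K} (hβ : β ^ n = 1) (c : Fin n → ZMod 2)
    (s : Fin n) :
    aeval β (codePoly n fun k => c (k + s)) * β ^ (s : ℕ) = aeval β (codePoly n c) := by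
  rw [aeval_codePoly, aeval_codePoly, Finset.sum_mul]
  refine Fintype.sum_equiv (Equiv.addRight s) _ _ fun k => ?_
  rw [Equiv.coe_addRight, pow_val_add hβ, mul_assoc]

theorem aeval_codePoly_neg [NeZero n] {β : K} (hβ : β ^ n = 1) (c : Fin n → ZMod 2) :
    aeval β (codePoly n fun k => c (-k)) = aeval β⁻¹ (codePoly n c) := by
  rw [aeval_codePoly, aeval_codePoly]
  refine Fintype.sum_equiv (Equiv.neg _) _ _ fun k => ?_
  rw [Equiv.neg_apply, inv_pow, eq_comm]
  congr 1
  refine inv_eq_of_mul_eq_one_right ?_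
  rw [← pow_val_add hβ]
  simp

/-- The BCH bound. -/
theorem lt_hammingNorm_of_consecutive_zeros (hα : IsPrimitiveRoot α n) {c : Fin n → ZMod 2}
    (hc : c ≠ 0) (b t : ℕ)
    (h : ∀ j, b ≤ j → j < b + t → aeval (α ^ j) (codePoly n c) = 0) : t < hammingNorm c := by
  by_contra! hw
  set A : Finset (Fin n) := Finset.univ.filter fun k => c k ≠ 0 with hA
  have hcard : A.card = hammingNorm c := rfl
  have hn : n ≠ 0 := by
    rintro rfl
    exact hc (Subsingleton.elim _ _)
  have hα0 : α ≠ 0 := hα.ne_zero hn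
  let e := A.equivFin
  -- If the weight is at most t, the zeros contain a square Vandermonde system with distinct nodes
  -- α^k, k in the support, and unknowns c_k α^(kb); these must all vanish.
  have hz : (fun j : Fin A.card => algebraMap (ZMod 2) K (c (e.symm j)) *
      (α ^ ((e.symm j : Fin n) : ℕ)) ^ b) = 0 := by
    refine Matrix.eq_zero_of_forall_pow_sum_mul_pow_eq_zero
      (f := fun j => α ^ ((e.symm j : Fin n) : ℕ)) ?_ ?_
    · intro i j hij
      exact e.symm.injective (Subtype.ext (Fin.ext (hα.pow_inj (Fin.is_lt _) (Fin.is_lt _) hij)))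
    · intro i
      have h1 := h (b + i) (by omega) (by have := i.2; omega)
      rw [aeval_codePoly, ← Finset.sum_subset (Finset.subset_univ A)] at h1
      · rw [← h1, ← Finset.sum_coe_sort A]
        refine Fintype.sum_equiv e.symm _ _ fun j => ?_
        rw [mul_assoc, ← pow_add, ← pow_mul, ← pow_mul, mul_comm _ (b + (i : ℕ))]
      · intro k _ hk
        have : c k = 0 := by simpa [hA] using hk
        simp [this]
  obtain ⟨k, hk⟩ := Function.ne_iff.1 hc
  have hkA : k ∈ A := by simpa [hA] using hk
  have := congrFun hz (e ⟨k, hkA⟩)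
  simp only [Equiv.symm_apply_apply, Pi.zero_apply] at this
  rcases mul_eq_zero.1 this with h1 | h1
  · exact hk ((algebraMap (ZMod 2) K).injective (by rw [h1, Pi.zero_apply, map_zero]))
  · exact pow_ne_zero _ (pow_ne_zero _ hα0) h1

end spectrum

/-! ### Binary weights and the exponent sets -/

theorem w2_two_pow_mul_add (k a b : ℕ) (hb : b < 2 ^ k) : w2 (2 ^ k * a + b) = w2 a + w2 b := by
  induction k generalizing b with
  | zero =>
    obtain rfl : b = 0 := by simpa using hb
    simp [w2]
  | succ k ih =>
    have hp : 2 ^ (k + 1) = 2 * 2 ^ k := by ring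
    rcases Nat.even_or_odd' b with ⟨i, rfl | rfl⟩
    · rw [hp, mul_assoc, ← mul_add, w2_two_mul, w2_two_mul, ih i (by omega)]
    · rw [hp, mul_assoc, ← add_assoc, ← mul_add, w2_two_mul_add_one, w2_two_mul_add_one,
        ih i (by omega), add_assoc]

/-- Subtraction from a string of k ones flips every digit without borrowing. -/
theorem w2_two_pow_sub_one_sub_add (k b : ℕ) (hb : b < 2 ^ k) :
    w2 (2 ^ k - 1 - b) + w2 b = k := by
  induction k generalizing b with
  | zero =>
    obtain rfl : b = 0 := by simpa using hb
    simp [w2]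
  | succ k ih =>
    have hp : 2 ^ (k + 1) = 2 * 2 ^ k := by ring
    rcases Nat.even_or_odd' b with ⟨i, rfl | rfl⟩
    · rw [show 2 ^ (k + 1) - 1 - 2 * i = 2 * (2 ^ k - 1 - i) + 1 by omega, w2_two_mul_add_one,
        w2_two_mul]
      have := ih i (by omega)
      omega
    · rw [show 2 ^ (k + 1) - 1 - (2 * i + 1) = 2 * (2 ^ k - 1 - i) by omega, w2_two_mul_add_one,
        w2_two_mul, ← add_assoc, ih i (by omega)]

/-- The first `2 ^ h` multiples of `2 ^ h - 1` all have `2`-weight `h`. -/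
theorem w2_two_pow_sub_one_mul (h i : ℕ) (hi : 1 ≤ i) (hi' : i ≤ 2 ^ h) :
    w2 ((2 ^ h - 1) * i) = h := by
  obtain ⟨j, rfl⟩ := Nat.exists_eq_add_of_le' hi
  -- The high digits are those of j and the low h digits are their complement, so the weights add up
  -- to h.
  have : (2 ^ h - 1) * (j + 1) = 2 ^ h * j + (2 ^ h - 1 - j) := by
    zify [Nat.one_le_two_pow (n := h), show j ≤ 2 ^ h - 1 by omega]
    ring
  rw [this, w2_two_pow_mul_add _ _ _ (by omega), add_comm,
    w2_two_pow_sub_one_sub_add _ _ (by omega)]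

theorem mem_weightSet {r m : ℕ} {S : Finset (ZMod r)} {j : ℕ} :
    j ∈ weightSet r m S ↔ (1 ≤ j ∧ j ≤ 2 ^ m - 2) ∧ (w2 j : ZMod r) ∈ S := by
  rw [weightSet, Finset.mem_filter, Finset.mem_Icc]

theorem lt_of_mem_weightSet {r m : ℕ} {S : Finset (ZMod r)} {j : ℕ} (hj : j ∈ weightSet r m S) :
    j < 2 ^ m - 1 := by
  have := (mem_weightSet.1 hj).1
  omega

theorem two_pow_sub_one_sub_mem_weightSet {r m : ℕ} {S : Finset (ZMod r)}
    (hS : ∀ s, s ∈ S ↔ (m : ZMod r) - s ∉ S) {j : ℕ} (h1 : 0 < j) (h2 : j < 2 ^ m - 1) :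
    2 ^ m - 1 - j ∈ weightSet r m S ↔ j ∉ weightSet r m S := by
  have h := congrArg (Nat.cast (R := ZMod r)) (w2_two_pow_sub_one_sub_add m j (by omega))
  rw [Nat.cast_add] at h
  rw [mem_weightSet, mem_weightSet, hS, ← h, add_sub_cancel_left]
  have h3 : 1 ≤ 2 ^ m - 1 - j ∧ 2 ^ m - 1 - j ≤ 2 ^ m - 2 := by omega
  have h4 : 1 ≤ j ∧ j ≤ 2 ^ m - 2 := by omega
  simp [h3, h4]

/-- The map j ↦ 2^m - 1 - j exchanges the set with its complement in [1, 2^m - 2], so it is exactly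
half of that interval. -/
theorem card_weightSet {r m : ℕ} {S : Finset (ZMod r)} (hm : m ≠ 0)
    (hS : ∀ s, s ∈ S ↔ (m : ZMod r) - s ∉ S) : (weightSet r m S).card = 2 ^ (m - 1) - 1 := by
  have h1 : ((Finset.Icc 1 (2 ^ m - 2)) \ weightSet r m S).card = (weightSet r m S).card := by
    refine Finset.card_nbij' (fun j => 2 ^ m - 1 - j) (fun j => 2 ^ m - 1 - j) ?_ ?_ ?_ ?_
    · intro j hj
      simp only [Finset.coe_sdiff, Set.mem_sdiff, Finset.mem_coe, Finset.mem_Icc] at hj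
      exact (two_pow_sub_one_sub_mem_weightSet hS (by omega) (by omega)).2 hj.2
    · intro j hj
      have hj' := (mem_weightSet.1 hj).1
      simp only [Finset.coe_sdiff, Set.mem_sdiff, Finset.mem_coe, Finset.mem_Icc]
      refine ⟨by omega, fun h => ?_⟩
      exact (two_pow_sub_one_sub_mem_weightSet hS (by omega) (by omega)).1 h hj
    · intro j hj
      simp only [Finset.coe_sdiff, Set.mem_sdiff, Finset.mem_coe, Finset.mem_Icc] at hj
      change 2 ^ m - 1 - (2 ^ m - 1 - j) = j
      omega
    · intro j hj
      have hj' := (mem_weightSet.1 hj).1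
      change 2 ^ m - 1 - (2 ^ m - 1 - j) = j
      omega
  have h2 := Finset.card_sdiff_add_card_eq_card (s := weightSet r m S)
    (t := Finset.Icc 1 (2 ^ m - 2)) (Finset.filter_subset _ _)
  rw [h1, Nat.card_Icc] at h2
  have hp : 2 ^ m = 2 * 2 ^ (m - 1) := by
    rw [← pow_succ', Nat.sub_add_cancel (Nat.pos_of_ne_zero hm)]
  omega

theorem mem_compl_iff_of_symm {r m : ℕ} [NeZero r] {S : Finset (ZMod r)}
    (hS : ∀ s, s ∈ S ↔ (m : ZMod r) - s ∉ S) (s : ZMod r) :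
    s ∈ Sᶜ ↔ (m : ZMod r) - s ∉ Sᶜ := by
  rw [Finset.mem_compl, Finset.mem_compl, not_not, hS s, not_not]

theorem mem_weightSet_compl {r m : ℕ} [NeZero r] {S : Finset (ZMod r)}
    (hS : ∀ s, s ∈ S ↔ (m : ZMod r) - s ∉ S) {j : ℕ} (h1 : 0 < j) (h2 : j < 2 ^ m - 1) :
    j ∈ weightSet r m Sᶜ ↔ 2 ^ m - 1 - j ∈ weightSet r m S := by
  rw [two_pow_sub_one_sub_mem_weightSet hS h1 h2, mem_weightSet, mem_weightSet, Finset.mem_compl]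
  have h4 : 1 ≤ j ∧ j ≤ 2 ^ m - 2 := by omega
  simp [h4]

theorem isUnionOfCosets_weightSet (r m : ℕ) [NeZero (2 ^ m - 1)] (S : Finset (ZMod r)) :
    IsUnionOfCosets {i : ZMod (2 ^ m - 1) | i.val ∈ weightSet r m S} := by
  refine ⟨{i : ZMod (2 ^ m - 1) | i.val ∈ weightSet r m S}, Set.Subset.antisymm ?_ ?_⟩
  · intro i hi
    exact Set.mem_biUnion hi ⟨0, by simp⟩
  · refine Set.iUnion₂_subset fun s hs => ?_
    rintro x ⟨t, rfl⟩
    induction t with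
    | zero => simpa using hs
    | succ t ih =>
      have h := two_mul_mod_mem_weightSet r m S _ ih
      rw [← ZMod.val_natCast] at h
      rw [Set.mem_ofPred_eq]
      convert h using 2
      push_cast
      rw [ZMod.natCast_zmod_val]
      ring

theorem isSplitting_weightSet {r m : ℕ} [NeZero r] [NeZero (2 ^ m - 1)] {S : Finset (ZMod r)}
    (hS : ∀ s, s ∈ S ↔ (m : ZMod r) - s ∉ S) :
    IsSplitting {i : ZMod (2 ^ m - 1) | i.val ∈ weightSet r m S}
      {i : ZMod (2 ^ m - 1) | i.val ∈ weightSet r m Sᶜ} (-1) := by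
  have hneg : ∀ i : ZMod (2 ^ m - 1), i ≠ 0 → (-i).val = 2 ^ m - 1 - i.val := fun i hi => by
    rw [ZMod.neg_val, if_neg hi]
  have h0 : ∀ {S : Finset (ZMod r)} {i : ZMod (2 ^ m - 1)}, i.val ∈ weightSet r m S → i ≠ 0 := by
    rintro S i hi rfl
    simpa using (mem_weightSet.1 hi).1.1
  have hval : ∀ i : ZMod (2 ^ m - 1), i ≠ 0 → 0 < i.val := fun i hi =>
    Nat.pos_of_ne_zero fun h => hi ((ZMod.val_eq_zero i).1 h)
  have himage : ∀ {S : Finset (ZMod r)}, (∀ s, s ∈ S ↔ (m : ZMod r) - s ∉ S) →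
      (fun i : ZMod (2 ^ m - 1) => i * ((-1 : (ZMod (2 ^ m - 1))ˣ) : ZMod (2 ^ m - 1))) ''
        {i : ZMod (2 ^ m - 1) | i.val ∈ weightSet r m S} =
      {i : ZMod (2 ^ m - 1) | i.val ∈ weightSet r m Sᶜ} := by
    intro S hS
    have hfun : (fun i : ZMod (2 ^ m - 1) => i * ((-1 : (ZMod (2 ^ m - 1))ˣ) : ZMod (2 ^ m - 1))) =
        fun i => -i := by
      funext i
      simp
    rw [hfun, Set.image_neg_eq_neg]
    ext i
    rw [Set.mem_neg, Set.mem_ofPred_eq, Set.mem_ofPred_eq]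
    by_cases hi : i = 0
    · subst hi
      exact ⟨fun h => (h0 h (by simp)).elim, fun h => (h0 h rfl).elim⟩
    · rw [hneg i hi, mem_weightSet_compl hS (hval i hi) i.val_lt]
  refine ⟨isUnionOfCosets_weightSet r m S, isUnionOfCosets_weightSet r m Sᶜ, ?_, ?_, himage hS, ?_⟩
  · ext i
    simp only [Set.mem_union, Set.mem_ofPred_eq, Set.mem_sdiff, Set.mem_univ, true_and,
      Set.mem_singleton_iff]
    constructor
    · rintro (h | h) <;> exact h0 h
    · intro hi
      rw [mem_weightSet_compl hS (hval i hi) i.val_lt,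
        two_pow_sub_one_sub_mem_weightSet hS (hval i hi) i.val_lt]
      exact em _
  · ext i
    simp only [Set.mem_inter_iff, Set.mem_ofPred_eq, Set.mem_empty_iff_false, iff_false, not_and]
    intro h1 h2
    exact Finset.mem_compl.1 (mem_weightSet.1 h2).2 (mem_weightSet.1 h1).2
  · simpa using himage (mem_compl_iff_of_symm hS)

/-! ### Weights and minimum distance -/

theorem natCast_hammingNorm {ι : Type*} [Fintype ι] (c : ι → ZMod 2) :
    (hammingNorm c : ZMod 2) = ∑ k, c k := by
  rw [hammingNorm, Finset.card_filter, Nat.cast_sum]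
  refine Finset.sum_congr rfl fun k _ => ?_
  generalize c k = x
  revert x
  decide

/-- Codes with the same weights share their minimum distance. The codeword returned attains it, so
lower bounds need only be checked on one nonzero word. -/
theorem exists_hasParameters {ι : Type*} [Fintype ι] {C C' : Submodule (ZMod 2) (ι → ZMod 2)}
    {N k : ℕ} (hN : Fintype.card ι = N) (hk : k ≠ 0) (h : Module.finrank (ZMod 2) C = k)
    (h' : Module.finrank (ZMod 2) C' = k)
    (hC : ∀ c ∈ C, ∃ c' ∈ C', hammingNorm c' = hammingNorm c)
    (hC' : ∀ c ∈ C', ∃ c' ∈ C, hammingNorm c' = hammingNorm c) :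
    ∃ d : ℕ, HasParameters C N k d ∧ HasParameters C' N k d ∧
      ∃ c ∈ C, c ≠ 0 ∧ hammingNorm c = d := by
  have hset : ∀ D : Submodule (ZMod 2) (ι → ZMod 2),
      {w : ℕ | ∃ x ∈ D, ∃ y ∈ D, x ≠ y ∧ hammingDist x y = w} =
      {w : ℕ | ∃ c ∈ D, c ≠ 0 ∧ hammingNorm c = w} := by
    intro D
    ext w
    constructor
    · rintro ⟨x, hx, y, hy, hxy, rfl⟩
      exact ⟨-x + y, D.add_mem (D.neg_mem hx) hy, fun h0 => hxy (neg_add_eq_zero.1 h0),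
        (hammingDist_eq_hammingNorm x y).symm⟩
    · rintro ⟨c, hc, hc0, rfl⟩
      exact ⟨0, D.zero_mem, c, hc, hc0.symm, congrFun hammingDist_zero_left c⟩
  have heq : {w : ℕ | ∃ c ∈ C, c ≠ 0 ∧ hammingNorm c = w} =
      {w : ℕ | ∃ c ∈ C', c ≠ 0 ∧ hammingNorm c = w} := by
    ext w
    constructor
    · rintro ⟨c, hc, hc0, rfl⟩
      obtain ⟨c', hc', hw⟩ := hC c hc
      exact ⟨c', hc', hammingNorm_ne_zero_iff.1 (hw ▸ hammingNorm_ne_zero_iff.2 hc0), hw⟩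
    · rintro ⟨c, hc, hc0, rfl⟩
      obtain ⟨c', hc', hw⟩ := hC' c hc
      exact ⟨c', hc', hammingNorm_ne_zero_iff.1 (hw ▸ hammingNorm_ne_zero_iff.2 hc0), hw⟩
  have hne : {w : ℕ | ∃ c ∈ C, c ≠ 0 ∧ hammingNorm c = w}.Nonempty := by
    have hbot : C ≠ ⊥ := by
      rintro rfl
      exact hk (by rw [← h, finrank_bot])
    obtain ⟨c, hc, hc0⟩ := C.exists_mem_ne_zero_of_ne_bot hbot
    exact ⟨_, c, hc, hc0, rfl⟩
  have hleast : IsLeast _ _ := ⟨Nat.sInf_mem hne, fun w hw => Nat.sInf_le hw⟩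
  refine ⟨_, ⟨hN, h, ?_⟩, ⟨hN, h', ?_⟩, Nat.sInf_mem hne⟩
  · rw [hset]
    exact hleast
  · rw [hset, ← heq]
    exact hleast

/-! ### Extended codes -/

section extended

variable {n : ℕ}

theorem hammingNorm_succ (c : Fin (n + 1) → ZMod 2) :
    hammingNorm c =
      hammingNorm (fun k : Fin n => c k.castSucc) + if c (Fin.last n) ≠ 0 then 1 else 0 := by
  simp only [hammingNorm, Finset.card_filter]
  exact Fin.sum_univ_castSucc _

theorem last_eq_of_mem_extendedCode {C : Submodule (ZMod 2) (Fin n → ZMod 2)}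
    {c : Fin (n + 1) → ZMod 2} (hc : c ∈ extendedCode C) :
    c (Fin.last n) = ∑ k : Fin n, c k.castSucc := by
  have h := hc.2
  rw [Fin.sum_univ_castSucc] at h
  rw [eq_comm, ← sub_eq_zero, CharTwo.sub_eq_add, h]

theorem hammingNorm_of_mem_extendedCode {C : Submodule (ZMod 2) (Fin n → ZMod 2)}
    {c : Fin (n + 1) → ZMod 2} (hc : c ∈ extendedCode C) :
    hammingNorm c = hammingNorm (fun k : Fin n => c k.castSucc) +
      hammingNorm (fun k : Fin n => c k.castSucc) % 2 := by
  rw [hammingNorm_succ, last_eq_of_mem_extendedCode hc, ← natCast_hammingNorm]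
  split_ifs with h <;> rw [ne_eq, ZMod.natCast_eq_zero_iff] at h <;> omega

/-- Every vector of length `n` has an extension by an overall parity coordinate. -/
theorem snoc_mem_extendedCode {C : Submodule (ZMod 2) (Fin n → ZMod 2)} {c : Fin n → ZMod 2}
    (hc : c ∈ C) : (Fin.snoc c (∑ k, c k) : Fin (n + 1) → ZMod 2) ∈ extendedCode C := by
  refine ⟨?_, ?_⟩
  · simpa using hc
  · simp only [Fin.sum_univ_castSucc, Fin.snoc_castSucc, Fin.snoc_last]
    exact CharTwo.add_self_eq_zero _

theorem finrank_extendedCode (C : Submodule (ZMod 2) (Fin n → ZMod 2)) :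
    Module.finrank (ZMod 2) (extendedCode C) = Module.finrank (ZMod 2) C := by
  let f : extendedCode C →ₗ[ZMod 2] C :=
    (LinearMap.funLeft (ZMod 2) (ZMod 2) (Fin.castSucc (n := n))).restrict fun c hc => hc.1
  refine LinearEquiv.finrank_eq (LinearEquiv.ofBijective f ⟨?_, ?_⟩)
  · rintro ⟨a, ha⟩ ⟨b, hb⟩ hab
    have h1 : (fun k : Fin n => a k.castSucc) = fun k : Fin n => b k.castSucc :=
      congrArg Subtype.val hab
    refine Subtype.ext (funext fun k => ?_)
    refine Fin.lastCases ?_ (fun k => ?_) k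
    · change a (Fin.last n) = b (Fin.last n)
      rw [last_eq_of_mem_extendedCode ha, last_eq_of_mem_extendedCode hb]
      exact congrArg (fun c : Fin n → ZMod 2 => ∑ k, c k) h1
    · exact congrFun h1 k
  · rintro ⟨c, hc⟩
    refine ⟨⟨_, snoc_mem_extendedCode hc⟩, Subtype.ext (funext fun k => ?_)⟩
    exact Fin.snoc_castSucc (α := fun _ => ZMod 2) _ _ _

end extended

/-! ### The codes defined by binary weights -/

section weightCode

variable {K : Type*} [Field K] {m : ℕ} {α : Kˣ}

theorem inv_pow_eq_pow_sub (hα : IsPrimitiveRoot (α : K) (2 ^ m - 1)) {i : ℕ}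
    (hi : i ≤ 2 ^ m - 1) : ((α : K) ^ i)⁻¹ = (α : K) ^ (2 ^ m - 1 - i) := by
  refine inv_eq_of_mul_eq_one_right ?_
  rw [← pow_add, Nat.add_sub_cancel' hi, hα.pow_eq_one]

/-- gcd(2^h - 1, 2^m - 1) = 2^gcd(h, m) - 1 = 1, since m = 2h + 1. -/
theorem isPrimitiveRoot_pow_two_pow_sub_one (hα : IsPrimitiveRoot (α : K) (2 ^ m - 1)) {h : ℕ}
    (hm : m = 2 * h + 1) : IsPrimitiveRoot ((α : K) ^ (2 ^ h - 1)) (2 ^ m - 1) := by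
  refine hα.pow_of_coprime _ ?_
  have hg : Nat.gcd h m = 1 := by simp [hm]
  rw [Nat.Coprime, Nat.pow_sub_one_gcd_pow_sub_one, hg]
  norm_num

variable [Algebra (ZMod 2) K] {r : ℕ} {hK : Nat.card K = 2 ^ m} {S : Finset (ZMod r)}

theorem mem_weightCode_iff (hα : IsPrimitiveRoot (α : K) (2 ^ m - 1))
    (c : Fin (2 ^ m - 1) → ZMod 2) : c ∈ weightCode r hK α S ↔
      ∀ i ∈ weightSet r m S, aeval ((α : K) ^ i) (codePoly _ c) = 0 :=
  mem_cyclicCode_iff_aeval hα (fun _ => lt_of_mem_weightSet) (weightGenerator_map r hK α S) c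

theorem finrank_weightCode (hm : m ≠ 0) (hα : IsPrimitiveRoot (α : K) (2 ^ m - 1))
    (hS : ∀ s, s ∈ S ↔ (m : ZMod r) - s ∉ S) :
    Module.finrank (ZMod 2) (weightCode r hK α S) = 2 ^ (m - 1) := by
  have hp : 2 ^ m = 2 * 2 ^ (m - 1) := by
    rw [← pow_succ', Nat.sub_add_cancel (Nat.pos_of_ne_zero hm)]
  have hp' := Nat.one_le_two_pow (n := m - 1)
  rw [weightCode, finrank_cyclicCode_of_map_eq_prod (by omega) hα
    (fun _ => lt_of_mem_weightSet) (weightGenerator_map r hK α S), card_weightSet hm hS]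
  omega

theorem odd_two_pow_sub_one (hm : m ≠ 0) : Odd (2 ^ m - 1) := by
  rw [Nat.odd_iff]
  have h2 : 2 ∣ 2 ^ m := dvd_pow_self 2 hm
  have := Nat.one_le_two_pow (n := m)
  omega

/-- For 0 < i < n, either i is a zero of c or n - i is a zero of d. -/
theorem dotProduct_of_mem_weightCode (hm : m ≠ 0) (hα : IsPrimitiveRoot (α : K) (2 ^ m - 1))
    (hS : ∀ s, s ∈ S ↔ (m : ZMod r) - s ∉ S) {c d : Fin (2 ^ m - 1) → ZMod 2}
    (hc : c ∈ weightCode r hK α S) (hd : d ∈ weightCode r hK α S) :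
    c ⬝ᵥ d = (∑ k, c k) * ∑ k, d k := by
  refine dotProduct_eq_sum_mul_sum hα (odd_two_pow_sub_one hm) fun i h1 h2 => ?_
  by_cases hi : i ∈ weightSet r m S
  · exact Or.inl ((mem_weightCode_iff hα c).1 hc i hi)
  · rw [inv_pow_eq_pow_sub hα h2.le]
    exact Or.inr ((mem_weightCode_iff hα d).1 hd _
      ((two_pow_sub_one_sub_mem_weightSet hS h1 h2).2 hi))

theorem shift_mem_weightCode [NeZero (2 ^ m - 1)] (hα : IsPrimitiveRoot (α : K) (2 ^ m - 1))
    {c : Fin (2 ^ m - 1) → ZMod 2} (hc : c ∈ weightCode r hK α S) (s : Fin (2 ^ m - 1)) :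
    (fun k => c (k + s)) ∈ weightCode r hK α S := by
  rw [mem_weightCode_iff hα] at hc ⊢
  intro i hi
  have hβ : ((α : K) ^ i) ^ (2 ^ m - 1) = 1 := by
    rw [← pow_mul, mul_comm, pow_mul, hα.pow_eq_one, one_pow]
  have h := aeval_codePoly_shift hβ c s
  rw [hc i hi] at h
  exact (mul_eq_zero.1 h).resolve_right (pow_ne_zero _ (pow_ne_zero _ α.ne_zero))

theorem neg_mem_weightCode_compl [NeZero r] [NeZero (2 ^ m - 1)]
    (hα : IsPrimitiveRoot (α : K) (2 ^ m - 1))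
    (hS : ∀ s, s ∈ S ↔ (m : ZMod r) - s ∉ S) {c : Fin (2 ^ m - 1) → ZMod 2}
    (hc : c ∈ weightCode r hK α S) : (fun k => c (-k)) ∈ weightCode r hK α Sᶜ := by
  rw [mem_weightCode_iff hα] at hc ⊢
  intro i hi
  have hβ : ((α : K) ^ i) ^ (2 ^ m - 1) = 1 := by
    rw [← pow_mul, mul_comm, pow_mul, hα.pow_eq_one, one_pow]
  have hi' := lt_of_mem_weightSet hi
  rw [aeval_codePoly_neg hβ, inv_pow_eq_pow_sub hα hi'.le]
  exact hc _ ((mem_weightSet_compl hS (mem_weightSet.1 hi).1.1 hi').1 hi)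

theorem hammingNorm_comp_neg {n : ℕ} [NeZero n] (c : Fin n → ZMod 2) :
    hammingNorm (fun k => c (-k)) = hammingNorm c := by
  simp only [hammingNorm, Finset.card_filter]
  exact Fintype.sum_equiv (Equiv.neg _) _ _ fun k => rfl

theorem sum_comp_neg {n : ℕ} [NeZero n] (c : Fin n → ZMod 2) : ∑ k, c (-k) = ∑ k, c k :=
  Fintype.sum_equiv (Equiv.neg _) _ _ fun _ => rfl

/-- Modulo 2, the autocorrelation of the support at s is the inner product of c with its shift,
hence the square of the parity of c. -/
theorem four_dvd_hammingNorm_of_mem_weightCode (hm : 2 ≤ m)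
    (hα : IsPrimitiveRoot (α : K) (2 ^ m - 1)) (hS : ∀ s, s ∈ S ↔ (m : ZMod r) - s ∉ S)
    {c : Fin (2 ^ m - 1) → ZMod 2} (hc : c ∈ weightCode r hK α S) :
    4 ∣ hammingNorm c + hammingNorm c % 2 := by
  obtain ⟨q, hq⟩ : 2 ^ 2 ∣ 2 ^ m := pow_dvd_pow 2 hm
  have hpos := Nat.one_le_two_pow (n := m)
  have : NeZero (2 ^ m - 1) := ⟨by omega⟩
  refine card_add_mod_two_mod_four (by rw [Fintype.card_fin]; omega)
    (Finset.univ.filter fun k => c k ≠ 0) fun s => ?_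
  have hd := dotProduct_of_mem_weightCode (by omega) hα hS hc (shift_mem_weightCode hα hc s)
  have hs : ∑ k, c (k + s) = ∑ k, c k := Fintype.sum_equiv (Equiv.addRight s) _ _ fun _ => rfl
  have hsq : ∀ x : ZMod 2, x * x = x := by decide
  rw [hs, hsq, ← natCast_hammingNorm] at hd
  rw [← Nat.ModEq, ← ZMod.natCast_eq_natCast_iff]
  refine Eq.trans ?_ hd
  simp only [Finset.mem_filter, Finset.mem_univ, true_and, Finset.filter_filter]
  rw [Finset.card_filter, Nat.cast_sum]
  refine Finset.sum_congr rfl fun k _ => ?_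
  change _ = c k * c (k + s)
  generalize c k = x
  generalize c (k + s) = y
  revert x y
  decide

theorem two_pow_sub_one_mul_mem_weightSet {h : ℕ} (hm : m = 2 * h + 1) (h0 : h ≠ 0)
    (hS : (h : ZMod r) ∈ S) {j : ℕ} (h1 : 1 ≤ j) (h2 : j ≤ 2 ^ h) :
    (2 ^ h - 1) * j ∈ weightSet r m S := by
  rw [mem_weightSet, w2_two_pow_sub_one_mul h j h1 h2]
  refine ⟨⟨?_, ?_⟩, hS⟩
  · have : 2 ≤ 2 ^ h := Nat.le_self_pow h0 2
    exact Nat.mul_pos (by omega) h1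
  · have h3 : (2 ^ h - 1) * j ≤ (2 ^ h - 1) * 2 ^ h := Nat.mul_le_mul_left _ h2
    have h4 : 2 ^ m = 2 * (2 ^ h * 2 ^ h) := by
      rw [hm]
      ring
    have h5 : (2 ^ h - 1) * 2 ^ h = 2 ^ h * 2 ^ h - 2 ^ h := by rw [Nat.sub_mul, one_mul]
    have h6 : 2 ≤ 2 ^ h := Nat.le_self_pow h0 2
    omega

/-- If h ∈ S the multiples of 2^h - 1 are themselves zeros; otherwise their negatives are, by the
symmetry of S, and β is the inverse root. -/
theorem exists_consecutive_zeros (hα : IsPrimitiveRoot (α : K) (2 ^ m - 1)) {h : ℕ}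
    (hm : m = 2 * h + 1) (h0 : h ≠ 0) (hS : ∀ s, s ∈ S ↔ (m : ZMod r) - s ∉ S) :
    ∃ β : K, IsPrimitiveRoot β (2 ^ m - 1) ∧ ∀ c ∈ weightCode r hK α S, ∀ j, 1 ≤ j → j ≤ 2 ^ h →
      aeval (β ^ j) (codePoly _ c) = 0 := by
  have hprim := isPrimitiveRoot_pow_two_pow_sub_one hα hm
  by_cases hS' : (h : ZMod r) ∈ S
  · refine ⟨_, hprim, fun c hc j h1 h2 => ?_⟩
    rw [← pow_mul]
    exact (mem_weightCode_iff hα c).1 hc _ (two_pow_sub_one_mul_mem_weightSet hm h0 hS' h1 h2)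
  · refine ⟨_, hprim.inv, fun c hc j h1 h2 => ?_⟩
    have hmem := two_pow_sub_one_mul_mem_weightSet (S := {(h : ZMod r)}) hm h0
      (Finset.mem_singleton_self _) h1 h2
    have hlt := lt_of_mem_weightSet hmem
    rw [inv_pow, ← pow_mul, inv_pow_eq_pow_sub hα hlt.le]
    refine (mem_weightCode_iff hα c).1 hc _ ?_
    refine (two_pow_sub_one_sub_mem_weightSet hS (mem_weightSet.1 hmem).1.1 hlt).2 fun hj => ?_
    have := (mem_weightSet.1 hj).2
    rw [w2_two_pow_sub_one_mul h j h1 h2] at this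
    exact hS' this

theorem two_pow_lt_hammingNorm (hα : IsPrimitiveRoot (α : K) (2 ^ m - 1)) {h : ℕ}
    (hm : m = 2 * h + 1) (h0 : h ≠ 0) (hS : ∀ s, s ∈ S ↔ (m : ZMod r) - s ∉ S)
    {c : Fin (2 ^ m - 1) → ZMod 2} (hc : c ∈ weightCode r hK α S) (hc0 : c ≠ 0) :
    2 ^ h < hammingNorm c := by
  obtain ⟨β, hβ, hz⟩ := exists_consecutive_zeros (hK := hK) hα hm h0 hS
  exact lt_hammingNorm_of_consecutive_zeros hβ hc0 1 (2 ^ h) fun j h1 h2 =>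
    hz c hc j h1 (by omega)

/-- Even parity is a zero at exponent 0, which lengthens the run of zeros by one. -/
theorem two_pow_add_one_lt_hammingNorm (hα : IsPrimitiveRoot (α : K) (2 ^ m - 1)) {h : ℕ}
    (hm : m = 2 * h + 1) (h0 : h ≠ 0) (hS : ∀ s, s ∈ S ↔ (m : ZMod r) - s ∉ S)
    {c : Fin (2 ^ m - 1) → ZMod 2} (hc : c ∈ weightCode r hK α S) (hc0 : c ≠ 0)
    (hsum : ∑ k, c k = 0) : 2 ^ h + 1 < hammingNorm c := by
  obtain ⟨β, hβ, hz⟩ := exists_consecutive_zeros (hK := hK) hα hm h0 hS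
  refine lt_hammingNorm_of_consecutive_zeros hβ hc0 0 (2 ^ h + 1) fun j _ h2 => ?_
  rcases Nat.eq_zero_or_pos j with rfl | hj
  · rw [pow_zero, aeval_one_codePoly, hsum, map_zero]
  · exact hz c hc j hj (by omega)

theorem map_X_sub_one_mul_weightGenerator :
    ((X - 1) * weightGenerator r hK α S).map (algebraMap (ZMod 2) K) =
      ∏ i ∈ insert 0 (weightSet r m S), (X - C ((α : K) ^ i)) := by
  rw [Finset.prod_insert fun h => by simpa using (mem_weightSet.1 h).1.1, Polynomial.map_mul,
    weightGenerator_map]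
  simp

theorem lt_of_mem_insert_weightSet (hm : m ≠ 0) {i : ℕ} (hi : i ∈ insert 0 (weightSet r m S)) :
    i < 2 ^ m - 1 := by
  rcases Finset.mem_insert.1 hi with rfl | h
  · exact (odd_two_pow_sub_one hm).pos
  · exact lt_of_mem_weightSet h

theorem mem_cyclicCode_X_sub_one_mul_iff (hm : m ≠ 0) (hα : IsPrimitiveRoot (α : K) (2 ^ m - 1))
    (c : Fin (2 ^ m - 1) → ZMod 2) :
    c ∈ cyclicCode (2 ^ m - 1) ((X - 1) * weightGenerator r hK α S) ↔
      ∑ k, c k = 0 ∧ c ∈ weightCode r hK α S := by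
  rw [mem_cyclicCode_iff_aeval hα (fun _ => lt_of_mem_insert_weightSet hm)
    map_X_sub_one_mul_weightGenerator, Finset.forall_mem_insert, mem_weightCode_iff hα, pow_zero,
    aeval_one_codePoly, map_eq_zero_iff _ (algebraMap (ZMod 2) K).injective]

theorem finrank_cyclicCode_X_sub_one_mul (hm : m ≠ 0) (hα : IsPrimitiveRoot (α : K) (2 ^ m - 1))
    (hS : ∀ s, s ∈ S ↔ (m : ZMod r) - s ∉ S) :
    Module.finrank (ZMod 2) (cyclicCode (2 ^ m - 1) ((X - 1) * weightGenerator r hK α S)) =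
      2 ^ (m - 1) - 1 := by
  have hp : 2 ^ m = 2 * 2 ^ (m - 1) := by
    rw [← pow_succ', Nat.sub_add_cancel (Nat.pos_of_ne_zero hm)]
  have hp' := Nat.one_le_two_pow (n := m - 1)
  rw [finrank_cyclicCode_of_map_eq_prod (by omega) hα (fun _ => lt_of_mem_insert_weightSet hm)
    map_X_sub_one_mul_weightGenerator,
    Finset.card_insert_of_notMem fun h => by simpa using (mem_weightSet.1 h).1.1,
    card_weightSet hm hS]
  omega

/-- The dual of the code is its even-weight subcode. -/
theorem dualCode_weightCode (hm : m ≠ 0) (hα : IsPrimitiveRoot (α : K) (2 ^ m - 1))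
    (hS : ∀ s, s ∈ S ↔ (m : ZMod r) - s ∉ S) :
    dualCode (weightCode r hK α S) =
      cyclicCode (2 ^ m - 1) ((X - 1) * weightGenerator r hK α S) := by
  -- Even parity of x kills the product of parities; the dimensions are 2^(m-1) and 2^(m-1) - 1,
  -- with sum n.
  refine dualCode_eq_of_le (fun x hx c hc => ?_) ?_
  · rw [mem_cyclicCode_X_sub_one_mul_iff hm hα] at hx
    rw [dotProduct_of_mem_weightCode hm hα hS hx.2 hc, hx.1, zero_mul]
  · rw [finrank_weightCode hm hα hS, finrank_cyclicCode_X_sub_one_mul hm hα hS, Fintype.card_fin]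
    have hp : 2 ^ m = 2 * 2 ^ (m - 1) := by
      rw [← pow_succ', Nat.sub_add_cancel (Nat.pos_of_ne_zero hm)]
    have hp' := Nat.one_le_two_pow (n := m - 1)
    omega

theorem mem_dualCode_weightCode_iff (hm : m ≠ 0) (hα : IsPrimitiveRoot (α : K) (2 ^ m - 1))
    (hS : ∀ s, s ∈ S ↔ (m : ZMod r) - s ∉ S) (c : Fin (2 ^ m - 1) → ZMod 2) :
    c ∈ dualCode (weightCode r hK α S) ↔ ∑ k, c k = 0 ∧ c ∈ weightCode r hK α S := by
  rw [dualCode_weightCode hm hα hS, mem_cyclicCode_X_sub_one_mul_iff hm hα]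

theorem hasDefiningSet_dualCode_weightCode [NeZero (2 ^ m - 1)] (hm : m ≠ 0)
    (hα : IsPrimitiveRoot (α : K) (2 ^ m - 1)) (hS : ∀ s, s ∈ S ↔ (m : ZMod r) - s ∉ S) :
    HasDefiningSet (α : K) (dualCode (weightCode r hK α S))
      ({0} ∪ {i : ZMod (2 ^ m - 1) | i.val ∈ weightSet r m S}) := by
  rw [dualCode_weightCode hm hα hS]
  convert hasDefiningSet_of_map_eq_prod hα (fun _ => lt_of_mem_insert_weightSet hm)
    (map_X_sub_one_mul_weightGenerator (hK := hK) (S := S)) using 1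
  ext i
  simp [ZMod.val_eq_zero]

/-- The product of the two parity coordinates equals the inner product of the punctured words, so
the two cancel in characteristic 2. -/
theorem isSelfDual_extendedCode_weightCode (hm : m ≠ 0)
    (hα : IsPrimitiveRoot (α : K) (2 ^ m - 1)) (hS : ∀ s, s ∈ S ↔ (m : ZMod r) - s ∉ S) :
    IsSelfDual (extendedCode (weightCode r hK α S)) := by
  refine dualCode_eq_of_le (fun x hx c hc => ?_) ?_
  · rw [dotProduct, Fin.sum_univ_castSucc, last_eq_of_mem_extendedCode hx,
      last_eq_of_mem_extendedCode hc, ← dotProduct_of_mem_weightCode hm hα hS hx.1 hc.1]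
    exact CharTwo.add_self_eq_zero _
  · rw [finrank_extendedCode, finrank_weightCode hm hα hS, Fintype.card_fin]
    have hp : 2 ^ m = 2 * 2 ^ (m - 1) := by
      rw [← pow_succ', Nat.sub_add_cancel (Nat.pos_of_ne_zero hm)]
    have hp' := Nat.one_le_two_pow (n := m - 1)
    omega

theorem isDoublyEven_extendedCode_weightCode (hm : 2 ≤ m)
    (hα : IsPrimitiveRoot (α : K) (2 ^ m - 1)) (hS : ∀ s, s ∈ S ↔ (m : ZMod r) - s ∉ S) :
    IsDoublyEven (extendedCode (weightCode r hK α S)) := fun c hc => by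
  rw [hammingNorm_of_mem_extendedCode hc]
  exact four_dvd_hammingNorm_of_mem_weightCode hm hα hS hc.1

theorem isOddLikeDuadicPair_weightCode [NeZero r] [NeZero (2 ^ m - 1)]
    (hα : IsPrimitiveRoot (α : K) (2 ^ m - 1)) (hS : ∀ s, s ∈ S ↔ (m : ZMod r) - s ∉ S) :
    IsOddLikeDuadicPair (α : K) (weightCode r hK α S) (weightCode r hK α Sᶜ) :=
  ⟨_, _, -1, isSplitting_weightSet hS,
    hasDefiningSet_of_map_eq_prod hα (fun _ => lt_of_mem_weightSet) (weightGenerator_map r hK α S),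
    hasDefiningSet_of_map_eq_prod hα (fun _ => lt_of_mem_weightSet)
      (weightGenerator_map r hK α Sᶜ)⟩

theorem isEvenLikeDuadicPair_dualCode_weightCode [NeZero r] [NeZero (2 ^ m - 1)] (hm : m ≠ 0)
    (hα : IsPrimitiveRoot (α : K) (2 ^ m - 1)) (hS : ∀ s, s ∈ S ↔ (m : ZMod r) - s ∉ S) :
    IsEvenLikeDuadicPair (α : K) (dualCode (weightCode r hK α S))
      (dualCode (weightCode r hK α Sᶜ)) :=
  ⟨_, _, -1, isSplitting_weightSet hS, hasDefiningSet_dualCode_weightCode hm hα hS,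
    hasDefiningSet_dualCode_weightCode hm hα (mem_compl_iff_of_symm hS)⟩

/-- The minimum distance of the code, for `m = 2 * h + 1`. -/
theorem exists_hasParameters_weightCode [NeZero r] {h : ℕ} (hm : m = 2 * h + 1) (h0 : h ≠ 0)
    (hα : IsPrimitiveRoot (α : K) (2 ^ m - 1)) (hS : ∀ s, s ∈ S ↔ (m : ZMod r) - s ∉ S) :
    ∃ d : ℕ, HasParameters (weightCode r hK α S) (2 ^ m - 1) (2 ^ (m - 1)) d ∧
      HasParameters (weightCode r hK α Sᶜ) (2 ^ m - 1) (2 ^ (m - 1)) d ∧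
      2 ^ h + 1 ≤ d ∧ (2 ≤ h → 2 ^ h + 3 ≤ d) := by
  have hm0 : m ≠ 0 := by omega
  have hSc := mem_compl_iff_of_symm hS
  have : NeZero (2 ^ m - 1) := ⟨(odd_two_pow_sub_one hm0).pos.ne'⟩
  obtain ⟨d, h1, h2, c, hc, hc0, rfl⟩ := exists_hasParameters (C := weightCode r hK α S)
    (C' := weightCode r hK α Sᶜ) (Fintype.card_fin _) (by positivity)
    (finrank_weightCode hm0 hα hS) (finrank_weightCode hm0 hα hSc)
    (fun c hc => ⟨_, neg_mem_weightCode_compl hα hS hc, hammingNorm_comp_neg c⟩)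
    (fun c hc => ⟨_, compl_compl S ▸ neg_mem_weightCode_compl hα hSc hc, hammingNorm_comp_neg c⟩)
  have hlt := two_pow_lt_hammingNorm hα hm h0 hS hc hc0
  have h4 := four_dvd_hammingNorm_of_mem_weightCode (by omega) hα hS hc
  refine ⟨_, h1, h2, hlt, fun hh => ?_⟩
  -- The weight is 0 or 3 mod 4 and exceeds a multiple of 4, so it exceeds it by at least 3.
  have : 2 ^ 2 ∣ 2 ^ h := pow_dvd_pow 2 hh
  omega

/-- The minimum distance of the dual code, for `m = 2 * h + 1`. -/
theorem exists_hasParameters_dualCode_weightCode [NeZero r] {h : ℕ} (hm : m = 2 * h + 1)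
    (h0 : h ≠ 0) (hα : IsPrimitiveRoot (α : K) (2 ^ m - 1))
    (hS : ∀ s, s ∈ S ↔ (m : ZMod r) - s ∉ S) :
    ∃ d : ℕ, HasParameters (dualCode (weightCode r hK α S)) (2 ^ m - 1) (2 ^ (m - 1) - 1) d ∧
      HasParameters (dualCode (weightCode r hK α Sᶜ)) (2 ^ m - 1) (2 ^ (m - 1) - 1) d ∧
      2 ^ h + 2 ≤ d ∧ (2 ≤ h → 2 ^ h + 4 ≤ d) := by
  have hm0 : m ≠ 0 := by omega
  have hSc := mem_compl_iff_of_symm hS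
  have : NeZero (2 ^ m - 1) := ⟨(odd_two_pow_sub_one hm0).pos.ne'⟩
  have hk : 2 ^ (m - 1) - 1 ≠ 0 := by
    have : 2 ≤ 2 ^ (m - 1) := Nat.le_self_pow (by omega) 2
    omega
  have hmap : ∀ {S : Finset (ZMod r)}, (∀ s, s ∈ S ↔ (m : ZMod r) - s ∉ S) →
      ∀ c ∈ dualCode (weightCode r hK α S), (fun k => c (-k)) ∈ dualCode (weightCode r hK α Sᶜ) := by
    intro S hS c hc
    rw [mem_dualCode_weightCode_iff hm0 hα hS] at hc
    rw [mem_dualCode_weightCode_iff hm0 hα (mem_compl_iff_of_symm hS), sum_comp_neg]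
    exact ⟨hc.1, neg_mem_weightCode_compl hα hS hc.2⟩
  obtain ⟨d, h1, h2, c, hc, hc0, rfl⟩ := exists_hasParameters (C := dualCode (weightCode r hK α S))
    (C' := dualCode (weightCode r hK α Sᶜ)) (Fintype.card_fin _) hk
    (by rw [dualCode_weightCode hm0 hα hS, finrank_cyclicCode_X_sub_one_mul hm0 hα hS])
    (by rw [dualCode_weightCode hm0 hα hSc, finrank_cyclicCode_X_sub_one_mul hm0 hα hSc])
    (fun c hc => ⟨_, hmap hS c hc, hammingNorm_comp_neg c⟩)
    (fun c hc => ⟨_, compl_compl S ▸ hmap hSc c hc, hammingNorm_comp_neg c⟩)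
  rw [mem_dualCode_weightCode_iff hm0 hα hS] at hc
  have hlt := two_pow_add_one_lt_hammingNorm hα hm h0 hS hc.2 hc0 hc.1
  have h4 := four_dvd_hammingNorm_of_mem_weightCode (by omega) hα hS hc.2
  have heven := natCast_hammingNorm c
  rw [hc.1, ZMod.natCast_eq_zero_iff] at heven
  refine ⟨_, h1, h2, hlt, fun hh => ?_⟩
  -- An even weight is now a multiple of 4, and the next one after 2^h is 2^h + 4.
  have : 2 ^ 2 ∣ 2 ^ h := pow_dvd_pow 2 hh
  omega

/-- The minimum distance of the extended code, for `m = 2 * h + 1`. -/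
theorem exists_hasParameters_extendedCode_weightCode [NeZero r] {h : ℕ} (hm : m = 2 * h + 1)
    (h0 : h ≠ 0) (hα : IsPrimitiveRoot (α : K) (2 ^ m - 1))
    (hS : ∀ s, s ∈ S ↔ (m : ZMod r) - s ∉ S) :
    ∃ d : ℕ, HasParameters (extendedCode (weightCode r hK α S)) (2 ^ m) (2 ^ (m - 1)) d ∧
      HasParameters (extendedCode (weightCode r hK α Sᶜ)) (2 ^ m) (2 ^ (m - 1)) d ∧
      (2 ≤ h → 2 ^ h + 4 ≤ d) := by
  have hm0 : m ≠ 0 := by omega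
  have hSc := mem_compl_iff_of_symm hS
  have : NeZero (2 ^ m - 1) := ⟨(odd_two_pow_sub_one hm0).pos.ne'⟩
  have hmap : ∀ {S : Finset (ZMod r)}, (∀ s, s ∈ S ↔ (m : ZMod r) - s ∉ S) →
      ∀ c ∈ extendedCode (weightCode r hK α S), ∃ c' ∈ extendedCode (weightCode r hK α Sᶜ),
        hammingNorm c' = hammingNorm c := by
    intro S hS c hc
    refine ⟨_, snoc_mem_extendedCode (neg_mem_weightCode_compl hα hS hc.1), ?_⟩
    rw [hammingNorm_of_mem_extendedCode hc, hammingNorm_of_mem_extendedCode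
      (snoc_mem_extendedCode (neg_mem_weightCode_compl hα hS hc.1))]
    simp only [Fin.snoc_castSucc]
    rw [hammingNorm_comp_neg fun k : Fin (2 ^ m - 1) => c k.castSucc]
  obtain ⟨d, h1, h2, c, hc, hc0, rfl⟩ := exists_hasParameters
    (C := extendedCode (weightCode r hK α S)) (C' := extendedCode (weightCode r hK α Sᶜ))
    (N := 2 ^ m) (k := 2 ^ (m - 1)) (by rw [Fintype.card_fin, Nat.sub_add_cancel Nat.one_le_two_pow]) (by positivity)
    (by rw [finrank_extendedCode, finrank_weightCode hm0 hα hS])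
    (by rw [finrank_extendedCode, finrank_weightCode hm0 hα hSc])
    (hmap hS) (fun c hc => compl_compl S ▸ hmap hSc c hc)
  refine ⟨_, h1, h2, fun hh => ?_⟩
  have hnorm := hammingNorm_of_mem_extendedCode hc
  -- The parity coordinate is determined by the others, so puncturing cannot annihilate a nonzero
  -- word.
  have hc1 : (fun k : Fin (2 ^ m - 1) => c k.castSucc) ≠ 0 := by
    intro hz
    rw [hz, hammingNorm_zero] at hnorm
    exact hammingNorm_ne_zero_iff.2 hc0 hnorm
  have hlt := two_pow_lt_hammingNorm hα hm h0 hS hc.1 hc1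
  have h4 := four_dvd_hammingNorm_of_mem_weightCode (by omega) hα hS hc.1
  have : 2 ^ 2 ∣ 2 ^ h := pow_dvd_pow 2 hh
  omega

end weightCode

/-! ### Conclusion for r = 8 -/

theorem isPrimitiveRoot_of_forall_mem_zpowers {K : Type*} [Field K] {q : ℕ} (hq : q ≠ 0)
    (hK : Nat.card K = q) (α : Kˣ) (hα : ∀ x : Kˣ, x ∈ Subgroup.zpowers α) :
    IsPrimitiveRoot (α : K) (q - 1) := by
  have : Finite K := Nat.finite_of_card_ne_zero (hK ▸ hq)
  rw [IsPrimitiveRoot.coe_units_iff, ← hK, ← Nat.card_units,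
    ← orderOf_eq_card_of_forall_mem_zpowers hα]
  exact IsPrimitiveRoot.orderOf α

theorem theorem11 {K : Type*} [Field K] [Algebra (ZMod 2) K] (m : ℕ) (hm : m % 8 = 3)
    (hK : Nat.card K = 2 ^ m) (α : Kˣ) (hα : ∀ x : Kˣ, x ∈ Subgroup.zpowers α) :
    (∀ S : Finset (ZMod 8),
      S = {0, 1, 4, 6} ∨ S = {0, 1, 6, 7} ∨ S = {0, 2, 4, 5} ∨ S = {0, 2, 5, 7} →
      (IsOddLikeDuadicPair (α : K) (weightCode 8 hK α S) (weightCode 8 hK α Sᶜ) ∧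
        ∃ d : ℕ, HasParameters (weightCode 8 hK α S) (2 ^ m - 1) (2 ^ (m - 1)) d ∧
          HasParameters (weightCode 8 hK α Sᶜ) (2 ^ m - 1) (2 ^ (m - 1)) d ∧
          (m % 16 = 3 → 2 ^ ((m - 1) / 2) + 1 ≤ d) ∧
          (m % 16 = 11 → 2 ^ ((m - 1) / 2) + 3 ≤ d)) ∧
      (IsEvenLikeDuadicPair (α : K) (dualCode (weightCode 8 hK α S))
          (dualCode (weightCode 8 hK α Sᶜ)) ∧
        ∃ d : ℕ, HasParameters (dualCode (weightCode 8 hK α S))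
            (2 ^ m - 1) (2 ^ (m - 1) - 1) d ∧
          HasParameters (dualCode (weightCode 8 hK α Sᶜ)) (2 ^ m - 1) (2 ^ (m - 1) - 1) d ∧
          (m % 16 = 3 → 2 ^ ((m - 1) / 2) + 2 ≤ d) ∧
          (m % 16 = 11 → 2 ^ ((m - 1) / 2) + 4 ≤ d)) ∧
      (IsSelfDual (extendedCode (weightCode 8 hK α S)) ∧
        IsSelfDual (extendedCode (weightCode 8 hK α Sᶜ)) ∧
        IsDoublyEven (extendedCode (weightCode 8 hK α S)) ∧
        IsDoublyEven (extendedCode (weightCode 8 hK α Sᶜ)) ∧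
        ∃ d : ℕ, HasParameters (extendedCode (weightCode 8 hK α S)) (2 ^ m) (2 ^ (m - 1)) d ∧
          HasParameters (extendedCode (weightCode 8 hK α Sᶜ)) (2 ^ m) (2 ^ (m - 1)) d ∧
          (m ≠ 3 → 2 ^ ((m - 1) / 2) + 4 ≤ d))) ∧
    (∀ S : Finset (ZMod 8),
      S = {0, 1, 5, 7} ∨ S = {0, 2, 6, 7} →
      (IsOddLikeDuadicPair (α : K) (weightCode 8 hK α S) (weightCode 8 hK α Sᶜ) ∧
        ∃ d : ℕ, HasParameters (weightCode 8 hK α S) (2 ^ m - 1) (2 ^ (m - 1)) d ∧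
          HasParameters (weightCode 8 hK α Sᶜ) (2 ^ m - 1) (2 ^ (m - 1)) d ∧
          2 ^ ((m - 1) / 2) + 1 ≤ d) ∧
      (IsEvenLikeDuadicPair (α : K) (dualCode (weightCode 8 hK α S))
          (dualCode (weightCode 8 hK α Sᶜ)) ∧
        ∃ d : ℕ, HasParameters (dualCode (weightCode 8 hK α S))
            (2 ^ m - 1) (2 ^ (m - 1) - 1) d ∧
          HasParameters (dualCode (weightCode 8 hK α Sᶜ)) (2 ^ m - 1) (2 ^ (m - 1) - 1) d ∧
          2 ^ ((m - 1) / 2) + 2 ≤ d) ∧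
      (IsSelfDual (extendedCode (weightCode 8 hK α S)) ∧
        IsSelfDual (extendedCode (weightCode 8 hK α Sᶜ)) ∧
        IsDoublyEven (extendedCode (weightCode 8 hK α S)) ∧
        IsDoublyEven (extendedCode (weightCode 8 hK α Sᶜ)) ∧
        ∃ d : ℕ, HasParameters (extendedCode (weightCode 8 hK α S)) (2 ^ m) (2 ^ (m - 1)) d ∧
          HasParameters (extendedCode (weightCode 8 hK α Sᶜ)) (2 ^ m) (2 ^ (m - 1)) d ∧
          (m ≠ 3 → 2 ^ ((m - 1) / 2) + 4 ≤ d))) := by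
  obtain ⟨q, rfl⟩ : ∃ q, m = 8 * q + 3 := ⟨m / 8, by omega⟩
  set h := 4 * q + 1 with hh
  have hm' : 8 * q + 3 = 2 * h + 1 := by omega
  have hh2 : (8 * q + 3 - 1) / 2 = h := by omega
  have hm0 : 8 * q + 3 ≠ 0 := by omega
  have h0 : h ≠ 0 := by omega
  have hα' := isPrimitiveRoot_of_forall_mem_zpowers (by positivity) hK α hα
  have hcast : ((8 * q + 3 : ℕ) : ZMod 8) = 3 := by
    have h8 : (8 : ZMod 8) = 0 := rfl
    push_cast
    linear_combination (q : ZMod 8) * h8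
  have : NeZero (2 ^ (8 * q + 3) - 1) := ⟨(odd_two_pow_sub_one hm0).pos.ne'⟩
  rw [hh2]
  refine ⟨fun S hS => ?_, fun S hS => ?_⟩
  all_goals
    -- The particular sets S enter only here, through a finite check in ℤ/8.
    have hsymm : ∀ s, s ∈ S ↔ ((8 * q + 3 : ℕ) : ZMod 8) - s ∉ S := by
      rw [hcast]
      rcases hS with rfl | rfl | rfl | rfl <;> decide
    have hsymm' := mem_compl_iff_of_symm hsymm
    obtain ⟨d₁, h₁, h₁', hd₁, hd₁'⟩ :=
      exists_hasParameters_weightCode (hK := hK) hm' h0 hα' hsymm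
    obtain ⟨d₂, h₂, h₂', hd₂, hd₂'⟩ :=
      exists_hasParameters_dualCode_weightCode (hK := hK) hm' h0 hα' hsymm
    obtain ⟨d₃, h₃, h₃', hd₃⟩ :=
      exists_hasParameters_extendedCode_weightCode (hK := hK) hm' h0 hα' hsymm
    refine ⟨⟨isOddLikeDuadicPair_weightCode hα' hsymm, d₁, h₁, h₁', ?_⟩,
      ⟨isEvenLikeDuadicPair_dualCode_weightCode hm0 hα' hsymm, d₂, h₂, h₂', ?_⟩,
      isSelfDual_extendedCode_weightCode hm0 hα' hsymm,
      isSelfDual_extendedCode_weightCode hm0 hα' hsymm',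
      isDoublyEven_extendedCode_weightCode (by omega) hα' hsymm,
      isDoublyEven_extendedCode_weightCode (by omega) hα' hsymm',
      d₃, h₃, h₃', fun h3 => hd₃ (by omega)⟩
  -- m ≡ 11 (mod 16) excludes m = 3, so h ≥ 2 and the sharper bound applies.
  · exact ⟨fun _ => hd₁, fun h11 => hd₁' (by omega)⟩
  · exact ⟨fun _ => hd₂, fun h11 => hd₂' (by omega)⟩
  · exact hd₁
  · exact hd₂
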